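/- Let $\mathbb K\in\{\mathbb R,\mathbb C\}$. An operator system is a $*$-vector space $S$ over $\mathbb K$ with, for each $n$, a proper cone $M_n(S)_+$ of self-adjoint matrices such that $X^*M_n(S)_+X\subseteq M_m(S)_+$ for all scalar $n\times m$ matrices $X$, and with a self-adjoint element $e$ such that for every $n$ the matrix $e_n=\mathrm{diag}(e,\dots,e)$ is an Archimedean order unit of the self-adjoint part of $M_n(S)$ (the zero system is allowed). Its norm is determined by $\|s\|\le r \iff \begin{pmatrix} re & s\\ s^* & re\end{pmatrix}\in M_2(S)_+$ for $r\ge 0$. Let $\mathbf{OSys}$ be the category of operator systems, not necessarily complete, with unital completely positive linear maps as morphisms. Let $\mathbf{OSys}_c^{\wedge}\subset\mathbf{OSys}$ be the full subcategory of those operator systems $S$ that are complete and for which there are a compact Hausdorff space $X$ and a unital complete order embedding $S\hookrightarrow C(X)=C(X,\mathbb K)$. For a (possibly empty) compact convex subset $K$ of a Hausdorff locally convex real topological vector space, let $A(K)\subseteq C(K,\mathbb K)$ be the operator system of continuous affine $\mathbb K$-valued functions on $K$; $A$ is a contravariant functor on the category of such compact convex sets and continuous affine maps. Then: 1. The category $\mathbf{OSys}_c^{\wedge}$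 is complete (it has all small limits). 2. The inclusion functor $U_c:\mathbf{OSys}_c^{\wedge}\to\mathbf{OSys}$ is a right adjoint, so that $\mathbf{OSys}_c^{\wedge}$ is a full reflective subcategory of $\mathbf{OSys}$. 3. The category $\mathbf{OSys}_c^{\wedge}$ is locally $\aleph_1$-presentable. 4. The functor $U_c$ preserves $\aleph_1$-directed (equivalently, $\aleph_1$-filtered) colimits; and $A$ turns $\aleph_1$-codirected limits of compact convex sets into colimits of operator systems: $A(\varprojlim_\lambda K_\lambda)\cong\varinjlim_\lambda A(K_\lambda)$ in $\mathbf{OSys}$. -/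

import Mathlib

universe u

open CategoryTheory Limits

section OperatorSystems

open scoped ComplexOrder

/-- The matrix `X* A X` over `S`, for a scalar matrix `X` and a square matrix `A` over `S`. -/
def matrixConj {𝕜 : Type} [RCLike 𝕜] {S : Type u} [AddCommGroup S] [Module 𝕜 S] {m n : ℕ}
    (X : Matrix (Fin n) (Fin m) 𝕜) (A : Matrix (Fin n) (Fin n) S) : Matrix (Fin m) (Fin m) S :=
  Matrix.of fun i j => ∑ k, ∑ l, (star (X k i) * X l j) • A k l

/-- An (abstract) operator system structure on a `*`-vector space `S` over `𝕜 = ℝ` or `ℂ`: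
proper cones `cone n` of self-adjoint matrices in `M_n(S)`, compatible with conjugation by
(rectangular) scalar matrices, and a self-adjoint element `e` which is an
Archimedean matrix order unit.  The zero system (with `e = 0`) is allowed. -/
class OperatorSystem (𝕜 : Type) [RCLike 𝕜] (S : Type u) [AddCommGroup S] [Module 𝕜 S]
    [StarAddMonoid S] [StarModule 𝕜 S] where
  /-- the matrix order unit -/
  e : S
  /-- the positive matrices of size `n` -/
  cone (n : ℕ) : Set (Matrix (Fin n) (Fin n) S)
  isHermitian_of_mem {n : ℕ} {A : Matrix (Fin n) (Fin n) S} : A ∈ cone n → A.IsHermitian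
  zero_mem (n : ℕ) : (0 : Matrix (Fin n) (Fin n) S) ∈ cone n
  add_mem {n : ℕ} {A B : Matrix (Fin n) (Fin n) S} : A ∈ cone n → B ∈ cone n → A + B ∈ cone n
  smul_mem {n : ℕ} {A : Matrix (Fin n) (Fin n) S} {r : ℝ} :
    0 ≤ r → A ∈ cone n → (r : 𝕜) • A ∈ cone n
  eq_zero_of_mem_of_neg_mem {n : ℕ} {A : Matrix (Fin n) (Fin n) S} :
    A ∈ cone n → -A ∈ cone n → A = 0
  conj_mem {m n : ℕ} (X : Matrix (Fin n) (Fin m) 𝕜) {A : Matrix (Fin n) (Fin n) S} :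
    A ∈ cone n → matrixConj X A ∈ cone m
  star_e : star e = e
  /-- `e_n` is an order unit of `M_n(S)` -/
  exists_smul_sub_mem {n : ℕ} {A : Matrix (Fin n) (Fin n) S} : A.IsHermitian →
    ∃ r : ℝ, 0 < r ∧ (r : 𝕜) • Matrix.diagonal (fun _ => e) - A ∈ cone n
  /-- `e_n` is Archimedean -/
  archimedean {n : ℕ} {A : Matrix (Fin n) (Fin n) S} : A.IsHermitian →
    (∀ r : ℝ, 0 < r → (r : 𝕜) • Matrix.diagonal (fun _ => e) + A ∈ cone n) → A ∈ cone n

/-- An operator system over `𝕜`, not assumed to be complete. -/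
structure OSys (𝕜 : Type) [RCLike 𝕜] where
  /-- the underlying set -/
  carrier : Type u
  [addCommGroup : AddCommGroup carrier]
  [module : Module 𝕜 carrier]
  [starAddMonoid : StarAddMonoid carrier]
  [starModule : StarModule 𝕜 carrier]
  [operatorSystem : OperatorSystem 𝕜 carrier]

namespace OSys

attribute [instance] addCommGroup module starAddMonoid starModule operatorSystem

variable {𝕜 : Type} [RCLike 𝕜]

/-- The order unit of an operator system. -/
def unit (S : OSys.{u} 𝕜) : S.carrier := OperatorSystem.e 𝕜

/-- The cone of positive elements of `M_n(S)`. -/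
def cone (S : OSys.{u} 𝕜) (n : ℕ) : Set (Matrix (Fin n) (Fin n) S.carrier) :=
  OperatorSystem.cone 𝕜 n

/-- Unital completely positive linear maps. -/
@[ext]
structure Hom (S T : OSys.{u} 𝕜) where
  /-- the underlying linear map -/
  toLin : S.carrier →ₗ[𝕜] T.carrier
  map_unit : toLin S.unit = T.unit
  map_mem {n : ℕ} {A : Matrix (Fin n) (Fin n) S.carrier} : A ∈ S.cone n → A.map toLin ∈ T.cone n

/-- The category of operator systems and unital completely positive maps. -/
instance : Category.{u} (OSys.{u} 𝕜) where
  Hom S T := Hom S T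
  id S :=
    { toLin := LinearMap.id
      map_unit := rfl
      map_mem := fun h => h }
  comp f g :=
    { toLin := g.toLin ∘ₗ f.toLin
      map_unit := by simp [f.map_unit, g.map_unit]
      map_mem := fun h => g.map_mem (f.map_mem h) }

/-- `S.NormLE s r` means `‖s‖ ≤ r` for the norm of the operator system `S`, i.e. `r ≥ 0` and
the `2 × 2` matrix with rows `(r e, s)` and `(s*, r e)` is positive. -/
def NormLE (S : OSys.{u} 𝕜) (s : S.carrier) (r : ℝ) : Prop :=
  0 ≤ r ∧ !![(r : 𝕜) • S.unit, s; star s, (r : 𝕜) • S.unit] ∈ S.cone 2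

/-- `S` is complete: every Cauchy sequence converges in norm. -/
def IsComplete (S : OSys.{u} 𝕜) : Prop :=
  ∀ s : ℕ → S.carrier,
    (∀ ε : ℝ, 0 < ε → ∃ N, ∀ m n, N ≤ m → N ≤ n → S.NormLE (s m - s n) ε) →
    ∃ t : S.carrier, ∀ ε : ℝ, 0 < ε → ∃ N, ∀ n, N ≤ n → S.NormLE (s n - t) ε

/-- There are a compact Hausdorff space `X` and a unital complete order embedding `S → C(X)`.
A matrix over `C(X)` is positive when it is positive semidefinite at every point of `X`. -/
def IsCommutative (S : OSys.{u} 𝕜) : Prop :=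
  ∃ (X : Type u) (_ : TopologicalSpace X) (_ : CompactSpace X) (_ : T2Space X)
    (φ : S.carrier →ₗ[𝕜] C(X, 𝕜)),
    φ S.unit = 1 ∧
    ∀ (n : ℕ) (A : Matrix (Fin n) (Fin n) S.carrier),
      A ∈ S.cone n ↔ ∀ x : X, (A.map fun s => φ s x).PosSemidef

end OSys

/-- The full subcategory of `OSys` on the complete operator systems that embed into a
commutative `C*`-algebra. -/
abbrev OSysC (𝕜 : Type) [RCLike 𝕜] : Type (u + 1) :=
  ObjectProperty.FullSubcategory fun S : OSys.{u} 𝕜 => S.IsComplete ∧ S.IsCommutative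

/-- The inclusion functor of `OSysC` into `OSys`. -/
abbrev OSysC.inclusion (𝕜 : Type) [RCLike 𝕜] : OSysC.{u} 𝕜 ⥤ OSys.{u} 𝕜 :=
  ObjectProperty.ι _

end OperatorSystems

section FunctionSystems

open scoped ComplexOrder
open Matrix

lemma posSemidef_of_re {𝕜 : Type} [RCLike 𝕜] {n : ℕ} {A : Matrix (Fin n) (Fin n) 𝕜}
    (hA : A.IsHermitian) (h : ∀ v, 0 ≤ RCLike.re (star v ⬝ᵥ A *ᵥ v)) : A.PosSemidef := by
  refine Matrix.PosSemidef.of_dotProduct_mulVec_nonneg hA fun v => ?_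
  rw [RCLike.nonneg_iff]
  exact ⟨h v, hA.im_star_dotProduct_mulVec_self v⟩

lemma re_dotProduct_self {𝕜 : Type} [RCLike 𝕜] {n : ℕ} (v : Fin n → 𝕜) :
    RCLike.re (star v ⬝ᵥ v) = ∑ i, ‖v i‖ ^ 2 := by
  simp only [dotProduct, Pi.star_apply, map_sum]
  refine Finset.sum_congr rfl fun i _ => ?_
  rw [RCLike.star_def, RCLike.conj_mul]
  norm_cast

lemma posSemidef_smul_one_sub {𝕜 : Type} [RCLike 𝕜] {n : ℕ} {A : Matrix (Fin n) (Fin n) 𝕜}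
    (hA : A.IsHermitian) {r : ℝ} (h : ∑ i, ∑ j, ‖A i j‖ ≤ r) :
    ((r : 𝕜) • (1 : Matrix (Fin n) (Fin n) 𝕜) - A).PosSemidef := by
  refine posSemidef_of_re ?_ fun v => ?_
  · refine Matrix.IsHermitian.sub ?_ hA
    simp [Matrix.IsHermitian, Matrix.conjTranspose_smul]
  · rw [Matrix.sub_mulVec, Matrix.smul_mulVec, Matrix.one_mulVec, dotProduct_sub, dotProduct_smul,
      map_sub, smul_eq_mul, RCLike.re_ofReal_mul, re_dotProduct_self]
    set N := ∑ i, ‖v i‖ ^ 2 with hN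
    have hN0 : 0 ≤ N := by positivity
    have hle : ∀ i, ‖v i‖ ^ 2 ≤ N := fun i =>
      Finset.single_le_sum (f := fun i => ‖v i‖ ^ 2) (fun _ _ => by positivity) (Finset.mem_univ i)
    have : RCLike.re (star v ⬝ᵥ A *ᵥ v) ≤ (∑ i, ∑ j, ‖A i j‖) * N := by
      refine (RCLike.re_le_norm _).trans ?_
      simp only [dotProduct, mulVec, Finset.mul_sum, Finset.sum_mul]
      refine (norm_sum_le _ _).trans (Finset.sum_le_sum fun i _ => ?_)
      refine (norm_sum_le _ _).trans (Finset.sum_le_sum fun j _ => ?_)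
      rw [norm_mul, norm_mul, Pi.star_apply, norm_star]
      have h1 : ‖v i‖ * ‖v j‖ ≤ N := by
        nlinarith [hle i, hle j, sq_nonneg (‖v i‖ - ‖v j‖)]
      nlinarith [norm_nonneg (A i j)]
    nlinarith

lemma posSemidef_of_smul_one_add {𝕜 : Type} [RCLike 𝕜] {n : ℕ} {A : Matrix (Fin n) (Fin n) 𝕜}
    (hA : A.IsHermitian)
    (h : ∀ r : ℝ, 0 < r → ((r : 𝕜) • (1 : Matrix (Fin n) (Fin n) 𝕜) + A).PosSemidef) :
    A.PosSemidef := by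
  refine posSemidef_of_re hA fun v => ?_
  have key : ∀ r : ℝ, 0 < r → 0 ≤ r * (∑ i, ‖v i‖ ^ 2) + RCLike.re (star v ⬝ᵥ A *ᵥ v) := by
    intro r hr
    have := (h r hr).re_dotProduct_nonneg v
    rwa [Matrix.add_mulVec, Matrix.smul_mulVec, Matrix.one_mulVec, dotProduct_add,
      dotProduct_smul, map_add, smul_eq_mul, RCLike.re_ofReal_mul, re_dotProduct_self] at this
  set N := ∑ i, ‖v i‖ ^ 2 with hN
  have hN0 : 0 ≤ N := by positivity
  by_contra! hneg
  set c := RCLike.re (star v ⬝ᵥ A *ᵥ v)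
  have := key (-c / (2 * (N + 1))) (by apply div_pos <;> linarith)
  have h2 : -c / (2 * (N + 1)) * N ≤ -c / 2 := by
    rw [div_mul_eq_mul_div, div_le_div_iff₀ (by positivity) (by positivity)]
    nlinarith
  linarith
lemma posSemidef_eq_zero {𝕜 : Type} [RCLike 𝕜] {n : ℕ} {A : Matrix (Fin n) (Fin n) 𝕜}
    (h : A.PosSemidef) (h' : (-A).PosSemidef) : A = 0 := by
  refine h.trace_eq_zero_iff.1 (le_antisymm ?_ h.trace_nonneg)
  have := h'.trace_nonneg
  rwa [Matrix.trace_neg, neg_nonneg] at this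

variable {𝕜 : Type} [RCLike 𝕜]

/-- A self-adjoint linear subspace of `C(X)` containing the constants, as an operator system
with the matrix order inherited from `C(X)`. -/
@[reducible]
noncomputable def functionSystem (X : Type u) [TopologicalSpace X] [CompactSpace X]
    (V : Submodule 𝕜 C(X, 𝕜)) (h1 : 1 ∈ V) (hstar : ∀ f ∈ V, star f ∈ V) : OSys.{u} 𝕜 :=
  letI : StarAddMonoid V :=
    { star := fun f => ⟨star f.1, hstar _ f.2⟩
      star_involutive := fun f => Subtype.ext (star_star f.1)
      star_add := fun f g => Subtype.ext (star_add f.1 g.1) }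
  letI : StarModule 𝕜 V := ⟨fun c f => Subtype.ext (star_smul c f.1)⟩
  { carrier := V
    operatorSystem :=
    { e := ⟨1, h1⟩
      cone := fun n => {A | ∀ x : X, (A.map fun f => f.1 x).PosSemidef}
      isHermitian_of_mem := by
        intro n A hA
        refine Matrix.IsHermitian.ext fun i j => Subtype.ext (ContinuousMap.ext fun x => ?_)
        exact (hA x).1.apply i j
      zero_mem := by
        intro n x
        have : ((0 : Matrix (Fin n) (Fin n) V).map fun f => f.1 x) = 0 := by ext; simp
        rw [this]
        exact Matrix.PosSemidef.zero
      add_mem := by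
        intro n A B hA hB x
        have : ((A + B).map fun f => f.1 x)
          = (A.map fun f => f.1 x) + (B.map fun f => f.1 x) := by ext; simp
        rw [this]
        exact (hA x).add (hB x)
      smul_mem := by
        intro n A r hr hA x
        have : (((r : 𝕜) • A).map fun f => f.1 x) = (r : 𝕜) • (A.map fun f => f.1 x) := by
          ext; simp [RCLike.real_smul_eq_coe_mul]
        rw [this]
        exact (hA x).smul (by exact_mod_cast hr)
      eq_zero_of_mem_of_neg_mem := by
        intro n A hA hA'
        ext i j x
        have h : (-A).map (fun f => f.1 x) = -(A.map fun f => f.1 x) := by ext; simp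
        have h' := hA' x
        rw [h] at h'
        exact congrFun (congrFun (posSemidef_eq_zero (hA x) h') i) j
      conj_mem := by
        intro m n B A hA x
        have : (matrixConj B A).map (fun f => f.1 x) = Bᴴ * (A.map fun f => f.1 x) * B := by
          ext i j
          simp only [matrixConj, Matrix.map_apply, Matrix.of_apply, Matrix.mul_apply,
            Matrix.conjTranspose_apply, Finset.sum_mul]
          rw [Finset.sum_comm]
          simp only [Submodule.coe_sum, Submodule.coe_smul, ContinuousMap.coe_sum,
            ContinuousMap.coe_smul, Finset.sum_apply, Pi.smul_apply, smul_eq_mul]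
          exact Finset.sum_congr rfl fun k _ => Finset.sum_congr rfl fun l _ => by ring
        rw [this]
        exact (hA x).conjTranspose_mul_mul_same B
      star_e := Subtype.ext (star_one _)
      exists_smul_sub_mem := by
        intro n A hA
        refine ⟨1 + ∑ i, ∑ j, ‖(A i j).1‖, by positivity, fun x => ?_⟩
        have hx : (A.map fun f => f.1 x).IsHermitian :=
          Matrix.IsHermitian.ext fun i j =>
            congrArg (fun f : V => f.1 x) (hA.apply i j)
        have key := posSemidef_smul_one_sub hx (r := 1 + ∑ i, ∑ j, ‖(A i j).1‖) (by
          have : ∑ i, ∑ j, ‖(A i j).1 x‖ ≤ ∑ i, ∑ j, ‖(A i j).1‖ :=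
            Finset.sum_le_sum fun i _ => Finset.sum_le_sum fun j _ =>
              ContinuousMap.norm_coe_le_norm _ x
          simp only [Matrix.map_apply]
          linarith)
        convert key using 1
        ext i j
        by_cases hij : i = j <;> simp [hij, Matrix.diagonal]
      archimedean := by
        intro n A hA h x
        have hx : (A.map fun f => f.1 x).IsHermitian :=
          Matrix.IsHermitian.ext fun i j =>
            congrArg (fun f : V => f.1 x) (hA.apply i j)
        refine posSemidef_of_smul_one_add hx fun r hr => ?_
        convert h r hr x using 1
        ext i j
        by_cases hij : i = j <;> simp [hij, Matrix.diagonal, RCLike.real_smul_eq_coe_mul] } }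

end FunctionSystems

section CompactConvexSets

/-- A (possibly empty) compact convex subset of a Hausdorff locally convex real
topological vector space. -/
structure CompactConvex where
  /-- the ambient space -/
  E : Type u
  [addCommGroup : AddCommGroup E]
  [module : Module ℝ E]
  [topologicalSpace : TopologicalSpace E]
  [isTopologicalAddGroup : IsTopologicalAddGroup E]
  [continuousSMul : ContinuousSMul ℝ E]
  [locallyConvexSpace : LocallyConvexSpace ℝ E]
  [t2Space : T2Space E]
  /-- the compact convex set -/
  K : Set E
  convex : Convex ℝ K
  isCompact : IsCompact K

namespace CompactConvex

attribute [instance] addCommGroup module topologicalSpace isTopologicalAddGroup continuousSMul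
  locallyConvexSpace t2Space

instance (C : CompactConvex.{u}) : CompactSpace C.K := isCompact_iff_compactSpace.1 C.isCompact

/-- A map from a compact convex set to a real vector space is affine if it respects convex
combinations. -/
def IsAffine (C : CompactConvex.{u}) {F : Type*} [AddCommGroup F] [Module ℝ F]
    (f : C.K → F) : Prop :=
  ∀ (x y z : C.K) (a b : ℝ), 0 ≤ a → 0 ≤ b → a + b = 1 →
    (z : C.E) = a • (x : C.E) + b • (y : C.E) → f z = a • f x + b • f y

/-- Continuous affine maps between compact convex sets. -/
@[ext]
structure Hom (C D : CompactConvex.{u}) where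
  /-- the underlying continuous map -/
  toMap : C(C.K, D.K)
  isAffine : C.IsAffine fun x => (toMap x : D.E)

/-- The category of compact convex sets and continuous affine maps. -/
instance : Category.{u} CompactConvex.{u} where
  Hom C D := Hom C D
  id C :=
    { toMap := ContinuousMap.id _
      isAffine := fun _ _ _ _ _ _ _ _ h => h }
  comp f g :=
    { toMap := g.toMap.comp f.toMap
      isAffine := fun x y z a b ha hb hab h =>
        g.isAffine (f.toMap x) (f.toMap y) (f.toMap z) a b ha hb hab
          (f.isAffine x y z a b ha hb hab h) }

variable (𝕜 : Type) [RCLike 𝕜]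

/-- The space of continuous affine `𝕜`-valued functions on a compact convex set. -/
def affineFunctions (C : CompactConvex.{u}) : Submodule 𝕜 C(C.K, 𝕜) where
  carrier := {f | C.IsAffine f}
  add_mem' {f g} hf hg := fun x y z a b ha hb hab h => by
    simp only [ContinuousMap.add_apply, hf x y z a b ha hb hab h, hg x y z a b ha hb hab h,
      smul_add]
    abel
  zero_mem' := fun x y z a b ha hb hab h => by simp
  smul_mem' c f hf := fun x y z a b ha hb hab h => by
    simp only [ContinuousMap.smul_apply, hf x y z a b ha hb hab h, smul_add, smul_comm c]

/-- The operator system `A(K)` of continuous affine `𝕜`-valued functions on a compact convex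
set `K`. -/
noncomputable abbrev affineSystem (C : CompactConvex.{u}) : OSys.{u} 𝕜 :=
  functionSystem C.K (affineFunctions 𝕜 C)
    (fun x y z a b ha hb hab h => by
      simp only [ContinuousMap.one_apply, ← add_smul, hab, one_smul])
    (fun f hf x y z a b ha hb hab h => by
      have := congrArg star (hf x y z a b ha hb hab h)
      simpa [RCLike.real_smul_eq_coe_mul] using this)

/-- The functor `K ↦ A(K)`, acting on morphisms by composition. -/
noncomputable def affineFunctor : CompactConvex.{u}ᵒᵖ ⥤ OSys.{u} 𝕜 where
  obj C := affineSystem 𝕜 C.unop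
  map {C D} f :=
    { toLin :=
        { toFun := fun g => ⟨g.1.comp f.unop.toMap, fun x y z a b ha hb hab h =>
            g.2 _ _ _ a b ha hb hab (f.unop.isAffine x y z a b ha hb hab h)⟩
          map_add' := fun _ _ => rfl
          map_smul' := fun _ _ => rfl }
      map_unit := rfl
      map_mem := fun h x => h (f.unop.toMap x) }

end CompactConvex

end CompactConvexSets

instance fact_isRegular_aleph_one : Fact (Cardinal.aleph 1 : Cardinal.{u}).IsRegular :=
  ⟨Cardinal.isRegular_aleph_one⟩

section States

open scoped ComplexOrder
open Matrix

variable {𝕜 : Type} [RCLike 𝕜]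

lemma posSemidef_iff_re {n : ℕ} {A : Matrix (Fin n) (Fin n) 𝕜} :
    A.PosSemidef ↔ A.IsHermitian ∧ ∀ v, 0 ≤ RCLike.re (star v ⬝ᵥ A *ᵥ v) :=
  ⟨fun h => ⟨h.1, fun v => h.re_dotProduct_nonneg v⟩, fun h => posSemidef_of_re h.1 h.2⟩

lemma posSemidef_two_iff {r : ℝ} {a b : 𝕜} (hr : 0 ≤ r) :
    (!![(r : 𝕜), a; b, (r : 𝕜)]).PosSemidef ↔ b = star a ∧ ‖a‖ ≤ r := by
  constructor
  · intro h
    have hb : b = star a := by simpa using (h.1.apply 1 0).symm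
    refine ⟨hb, ?_⟩
    have hd := h.det_nonneg
    rw [Matrix.det_fin_two_of, hb, RCLike.star_def, RCLike.mul_conj] at hd
    have hd' : (0 : ℝ) ≤ r * r - ‖a‖ ^ 2 := by exact_mod_cast hd
    nlinarith [norm_nonneg a]
  · rintro ⟨rfl, ha⟩
    refine posSemidef_of_re ?_ fun v => ?_
    · ext i j
      fin_cases i <;> fin_cases j <;> simp
    · have h1 : star v ⬝ᵥ (!![(r : 𝕜), a; star a, (r : 𝕜)]) *ᵥ v
          = (r : 𝕜) * (star (v 0) * v 0) + (r : 𝕜) * (star (v 1) * v 1)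
            + (star (v 0) * a * v 1 + star (star (v 0) * a * v 1)) := by
        simp [dotProduct, mulVec, Fin.sum_univ_two]
        ring
      rw [h1]
      have h2 : ∀ z : 𝕜, star z * z = ((‖z‖ ^ 2 : ℝ) : 𝕜) := fun z => by
        rw [RCLike.star_def, RCLike.conj_mul]; norm_cast
      rw [h2, h2]
      have h3 := (abs_le.1 (RCLike.abs_re_le_norm (star (v 0) * a * v 1))).1
      rw [norm_mul, norm_mul, norm_star] at h3
      simp only [map_add, RCLike.re_ofReal_mul, RCLike.ofReal_re, RCLike.star_def,
        RCLike.conj_re] at h3 ⊢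
      have h4 : ‖v 0‖ * ‖a‖ * ‖v 1‖ ≤ r * (‖v 0‖ * ‖v 1‖) := by
        have := mul_le_mul_of_nonneg_right ha (mul_nonneg (norm_nonneg (v 0)) (norm_nonneg (v 1)))
        linarith
      nlinarith [mul_nonneg hr (sq_nonneg (‖v 0‖ - ‖v 1‖))]

lemma isClosed_setOf_posSemidef {X : Type*} [TopologicalSpace X] {n : ℕ}
    {A : X → Matrix (Fin n) (Fin n) 𝕜} (hA : Continuous A) :
    IsClosed {x | (A x).PosSemidef} := by
  simp only [posSemidef_iff_re, Set.ofPred_and, Set.ofPred_forall]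
  refine IsClosed.inter ?_ (isClosed_iInter fun v => ?_)
  · exact isClosed_eq hA.matrix_conjTranspose hA
  · exact isClosed_le continuous_const
      (RCLike.continuous_re.comp (continuous_const.dotProduct (hA.matrix_mulVec continuous_const)))

namespace OSys

/-- The states of an operator system: unital completely positive functionals. -/
def stateSet (S : OSys.{u} 𝕜) : Set (S.carrier → 𝕜) :=
  {f | (∀ a b, f (a + b) = f a + f b) ∧ (∀ (c : 𝕜) a, f (c • a) = c * f a) ∧ f S.unit = 1 ∧
    ∀ (n : ℕ) (A : Matrix (Fin n) (Fin n) S.carrier), A ∈ S.cone n → (A.map f).PosSemidef}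

/-- The type of states of an operator system. -/
abbrev State (S : OSys.{u} 𝕜) : Type u := S.stateSet

namespace State

variable {S T : OSys.{u} 𝕜}

/-- A state as a linear functional. -/
def toLin (x : S.State) : S.carrier →ₗ[𝕜] 𝕜 where
  toFun := x.1
  map_add' := x.2.1
  map_smul' := x.2.2.1

lemma map_add (x : S.State) (a b : S.carrier) : x.1 (a + b) = x.1 a + x.1 b := x.2.1 a b
lemma map_sub (x : S.State) (a b : S.carrier) : x.1 (a - b) = x.1 a - x.1 b := x.toLin.map_sub a b
lemma map_neg (x : S.State) (a : S.carrier) : x.1 (-a) = -x.1 a := x.toLin.map_neg a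
lemma map_smul (x : S.State) (c : 𝕜) (a : S.carrier) : x.1 (c • a) = c * x.1 a := x.2.2.1 c a
lemma map_unit (x : S.State) : x.1 S.unit = 1 := x.2.2.2.1
lemma map_sum (x : S.State) {ι : Type*} (s : Finset ι) (f : ι → S.carrier) :
    x.1 (∑ i ∈ s, f i) = ∑ i ∈ s, x.1 (f i) := _root_.map_sum x.toLin f s
lemma posSemidef (x : S.State) {n : ℕ} {A : Matrix (Fin n) (Fin n) S.carrier}
    (hA : A ∈ S.cone n) : (A.map x.1).PosSemidef := x.2.2.2.2 n A hA

/-- The pullback of a state along a morphism. -/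
def comap (f : S ⟶ T) (x : T.State) : S.State :=
  ⟨fun s => x.1 (f.toLin s), fun a b => by dsimp only; rw [_root_.map_add, map_add],
    fun c a => by dsimp only; rw [_root_.map_smul, map_smul],
    by dsimp only; rw [f.map_unit, map_unit], fun _ _ hA => x.posSemidef (f.map_mem hA)⟩

lemma comap_apply (f : S ⟶ T) (x : T.State) (s : S.carrier) :
    (comap f x).1 s = x.1 (f.toLin s) := rfl

lemma continuous_eval (s : S.carrier) : Continuous fun x : S.State => x.1 s :=
  (continuous_apply s).comp continuous_subtype_val

lemma continuous_comap (f : S ⟶ T) : Continuous (comap f) :=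
  Continuous.subtype_mk (continuous_pi fun s => continuous_eval (f.toLin s)) _

end State

variable {S T : OSys.{u} 𝕜}

lemma hom_ext {f g : S ⟶ T} (h : ∀ s, f.toLin s = g.toLin s) : f = g :=
  Hom.ext (LinearMap.ext h)

lemma exists_normLE (s : S.carrier) : ∃ r, S.NormLE s r := by
  have hA : (!![0, -s; -star s, 0] : Matrix (Fin 2) (Fin 2) S.carrier).IsHermitian := by
    ext i j
    fin_cases i <;> fin_cases j <;> simp
  obtain ⟨r, hr, h⟩ := OperatorSystem.exists_smul_sub_mem (𝕜 := 𝕜) hA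
  refine ⟨r, hr.le, ?_⟩
  have e : !![(r : 𝕜) • S.unit, s; star s, (r : 𝕜) • S.unit]
      = (r : 𝕜) • diagonal (fun _ => OperatorSystem.e 𝕜) - !![0, -s; -star s, 0] := by
    ext i j
    fin_cases i <;> fin_cases j <;> simp [OSys.unit]
  rw [e]
  exact h

lemma NormLE.map {s : S.carrier} {r : ℝ} (h : S.NormLE s r) (x : S.State) :
    x.1 (star s) = star (x.1 s) ∧ ‖x.1 s‖ ≤ r := by
  refine (posSemidef_two_iff h.1).1 ?_
  convert x.posSemidef h.2 using 1
  ext i j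
  fin_cases i <;> fin_cases j <;> simp [x.map_smul, x.map_unit]

lemma State.map_star (x : S.State) (s : S.carrier) : x.1 (star s) = star (x.1 s) :=
  let ⟨_, h⟩ := exists_normLE s
  (h.map x).1

lemma State.norm_le (x : S.State) {s : S.carrier} {r : ℝ} (h : S.NormLE s r) : ‖x.1 s‖ ≤ r :=
  (h.map x).2

lemma isClosed_stateSet (S : OSys.{u} 𝕜) : IsClosed S.stateSet := by
  simp only [stateSet, Set.ofPred_and, Set.ofPred_forall]
  refine IsClosed.inter ?_ (IsClosed.inter ?_ (IsClosed.inter ?_ ?_))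
  · exact isClosed_iInter fun a => isClosed_iInter fun b => isClosed_eq (by fun_prop) (by fun_prop)
  · exact isClosed_iInter fun a => isClosed_iInter fun b => isClosed_eq (by fun_prop) (by fun_prop)
  · exact isClosed_eq (by fun_prop) (by fun_prop)
  · refine isClosed_iInter fun n => isClosed_iInter fun A => isClosed_iInter fun hA => ?_
    exact isClosed_setOf_posSemidef
      (continuous_matrix fun i j => continuous_apply (A i j))

lemma isCompact_stateSet (S : OSys.{u} 𝕜) : IsCompact S.stateSet := by
  choose r hr using fun s : S.carrier => exists_normLE (S := S) s
  refine IsCompact.of_isClosed_subset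
    (isCompact_univ_pi fun s => isCompact_closedBall (0 : 𝕜) (r s)) S.isClosed_stateSet ?_
  intro x hx s _
  rw [mem_closedBall_zero_iff]
  exact State.norm_le (⟨x, hx⟩ : S.State) (hr s)

lemma convex_stateSet (S : OSys.{u} 𝕜) : Convex ℝ S.stateSet := by
  intro x hx y hy a b ha hb hab
  refine ⟨fun s t => ?_, fun c s => ?_, ?_, fun n A hA => ?_⟩
  · simp only [Pi.add_apply, Pi.smul_apply, hx.1, hy.1, smul_add]
    abel
  · simp only [Pi.add_apply, Pi.smul_apply, hx.2.1, hy.2.1, RCLike.real_smul_eq_coe_mul]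
    ring
  · simp only [Pi.add_apply, Pi.smul_apply, hx.2.2.1, hy.2.2.1, ← add_smul, hab, one_smul]
  · have h : A.map (a • x + b • y) = (a : 𝕜) • A.map x + (b : 𝕜) • A.map y := by
      ext i j
      simp [RCLike.real_smul_eq_coe_mul]
    rw [h]
    exact ((hx.2.2.2 n A hA).smul (by exact_mod_cast ha)).add
      ((hy.2.2.2 n A hA).smul (by exact_mod_cast hb))

/-- The state space of an operator system, with the topology of pointwise convergence. -/
@[reducible]
noncomputable def stateSpace (S : OSys.{u} 𝕜) : CompactConvex.{u} where
  E := S.carrier → 𝕜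
  K := S.stateSet
  convex := S.convex_stateSet
  isCompact := S.isCompact_stateSet

instance (S : OSys.{u} 𝕜) : CompactSpace S.State :=
  isCompact_iff_compactSpace.1 S.isCompact_stateSet

/-- The states of `S` determine the matrix order. -/
def StateDetermined (S : OSys.{u} 𝕜) : Prop :=
  ∀ (n : ℕ) (A : Matrix (Fin n) (Fin n) S.carrier),
    (∀ x : S.State, (A.map x.1).PosSemidef) → A ∈ S.cone n

lemma IsCommutative.stateDetermined (h : S.IsCommutative) : S.StateDetermined := by
  obtain ⟨X, _, _, _, φ, h1, hφ⟩ := h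
  intro n A hA
  refine (hφ n A).2 fun p => ?_
  exact hA ⟨fun s => φ s p, fun a b => by simp, fun c a => by simp, by simp [h1],
    fun m B hB => (hφ m B).1 hB p⟩

lemma StateDetermined.ext (hS : S.StateDetermined) {s t : S.carrier}
    (h : ∀ x : S.State, x.1 s = x.1 t) : s = t := by
  have key : ∀ a : S.carrier, (∀ x : S.State, x.1 a = 0) →
      (!![a] : Matrix (Fin 1) (Fin 1) S.carrier) ∈ S.cone 1 := fun a ha => hS 1 _ fun x => by
    have : (!![a] : Matrix (Fin 1) (Fin 1) S.carrier).map x.1 = 0 := by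
      ext i j; simp [ha x]
    rw [this]
    exact PosSemidef.zero
  have h1 := key (s - t) fun x => by rw [x.map_sub, h, sub_self]
  have h2 := key (-(s - t)) fun x => by rw [x.map_neg, x.map_sub, h, sub_self, neg_zero]
  have h3 : (!![s - t] : Matrix (Fin 1) (Fin 1) S.carrier) = 0 :=
    OperatorSystem.eq_zero_of_mem_of_neg_mem (𝕜 := 𝕜) h1 (by
      have e : -(!![s - t] : Matrix (Fin 1) (Fin 1) S.carrier) = !![-(s - t)] := by
        ext i j; simp
      rw [e]
      exact h2)
  exact sub_eq_zero.1 (by simpa using congrFun (congrFun h3 0) 0)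

lemma StateDetermined.normLE (hS : S.StateDetermined) {s : S.carrier} {r : ℝ} (hr : 0 ≤ r)
    (h : ∀ x : S.State, ‖x.1 s‖ ≤ r) : S.NormLE s r := by
  refine ⟨hr, hS 2 _ fun x => ?_⟩
  convert (posSemidef_two_iff hr).2 ⟨rfl, h x⟩ using 1
  ext i j
  fin_cases i <;> fin_cases j <;> simp [x.map_smul, x.map_unit, x.map_star]

/-- A morphism into a system determined by its states, built from a map of states. -/
lemma exists_hom_of_stateMap (hT : T.StateDetermined) (g : T.State → S.State)
    (h : ∀ s, ∃ t, ∀ x : T.State, x.1 t = (g x).1 s) :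
    ∃ φ : S ⟶ T, ∀ s (x : T.State), x.1 (φ.toLin s) = (g x).1 s := by
  choose φ hφ using h
  refine ⟨⟨⟨⟨φ, fun a b => hT.ext fun x => ?_⟩, fun c a => hT.ext fun x => ?_⟩,
    hT.ext fun x => ?_, fun {n A} hA => hT n _ fun x => ?_⟩, hφ⟩
  · rw [hφ, x.map_add, hφ, hφ, (g x).map_add]
  · simp only [RingHom.id_apply]
    rw [hφ, x.map_smul, hφ, (g x).map_smul]
  · change x.1 (φ _) = _
    rw [hφ, x.map_unit, (g x).map_unit]
  · convert (g x).posSemidef hA using 1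
    ext i j
    exact hφ _ _

lemma StateDetermined.hom_ext (hT : T.StateDetermined) {f g : S ⟶ T}
    (h : ∀ s (x : T.State), x.1 (f.toLin s) = x.1 (g.toLin s)) : f = g :=
  OSys.hom_ext fun s => hT.ext (h s)

/-- Evaluation of states as a linear map into the continuous functions on the state space. -/
def evalState (S : OSys.{u} 𝕜) : S.carrier →ₗ[𝕜] C(S.State, 𝕜) where
  toFun s := ⟨fun x => x.1 s, State.continuous_eval s⟩
  map_add' a b := ContinuousMap.ext fun x => x.map_add a b
  map_smul' c a := ContinuousMap.ext fun x => x.map_smul c a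

lemma isClosed_range_evalState (hS : S.StateDetermined) (hc : S.IsComplete) :
    IsClosed (Set.range S.evalState) := by
  refine isClosed_of_closure_subset fun f hf => ?_
  obtain ⟨u, hu, hlim⟩ := mem_closure_iff_seq_limit.1 hf
  choose s hs using hu
  have hC := hlim.cauchySeq
  obtain ⟨t, ht⟩ := hc s fun ε hε => by
    obtain ⟨N, hN⟩ := Metric.cauchySeq_iff.1 hC ε hε
    refine ⟨N, fun m n hm hn => hS.normLE hε.le fun x => ?_⟩
    have h1 := (ContinuousMap.dist_apply_le_dist (f := u m) (g := u n) x).trans (hN m hm n hn).le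
    rw [← hs, ← hs, dist_eq_norm] at h1
    rw [x.map_sub]
    exact h1
  refine ⟨t, ContinuousMap.ext fun x => ?_⟩
  have h1 : Filter.Tendsto (fun n => u n x) Filter.atTop (nhds (f x)) :=
    ((continuous_eval_const x).tendsto f).comp hlim
  refine tendsto_nhds_unique (Metric.tendsto_atTop.2 fun ε hε => ?_) h1
  obtain ⟨N, hN⟩ := ht (ε / 2) (by positivity)
  refine ⟨N, fun n hn => ?_⟩
  have h2 := x.norm_le (hN n hn)
  rw [x.map_sub] at h2
  rw [dist_eq_norm, ← hs]
  exact h2.trans_lt (by linarith)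

lemma exists_forall_eq_of_mem_closure (hS : S.StateDetermined) (hc : S.IsComplete)
    {f : C(S.State, 𝕜)} (hf : f ∈ closure (Set.range S.evalState)) :
    ∃ s, ∀ x : S.State, x.1 s = f x := by
  rw [(isClosed_range_evalState hS hc).closure_eq] at hf
  obtain ⟨s, rfl⟩ := hf
  exact ⟨s, fun _ => rfl⟩

end OSys

section FunctionSystem

variable {X : Type u} [TopologicalSpace X] [CompactSpace X]
    {V : Submodule 𝕜 C(X, 𝕜)} (h1 : 1 ∈ V) (hstar : ∀ f ∈ V, star f ∈ V)

lemma functionSystem_normLE_iff (f : V) (r : ℝ) :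
    (functionSystem X V h1 hstar).NormLE f r ↔ 0 ≤ r ∧ ∀ x, ‖f.1 x‖ ≤ r := by
  refine and_congr_right fun hr => forall_congr' fun x => ?_
  refine Iff.trans ?_ ((posSemidef_two_iff (a := f.1 x) (b := star (f.1 x)) hr).trans
    (and_iff_right rfl))
  refine iff_of_eq (congrArg _ ?_)
  ext i j
  fin_cases i <;> fin_cases j
  · exact (mul_one (r : 𝕜))
  · rfl
  · rfl
  · exact (mul_one (r : 𝕜))

lemma isComplete_functionSystem (hV : IsClosed (V : Set C(X, 𝕜))) :
    (functionSystem X V h1 hstar).IsComplete := by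
  intro s hs
  have hC : CauchySeq fun n => (s n).1 := by
    refine Metric.cauchySeq_iff.2 fun ε hε => ?_
    obtain ⟨N, hN⟩ := hs (ε / 2) (by positivity)
    refine ⟨N, fun m hm n hn => ?_⟩
    have := ((functionSystem_normLE_iff h1 hstar _ _).1 (hN m n hm hn)).2
    rw [dist_eq_norm]
    refine lt_of_le_of_lt ((ContinuousMap.norm_le _ (by positivity)).2 this) (by linarith)
  obtain ⟨t, ht⟩ := cauchySeq_tendsto_of_complete hC
  have htV : t ∈ V := hV.mem_of_tendsto ht (Filter.Eventually.of_forall fun n => (s n).2)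
  refine ⟨⟨t, htV⟩, fun ε hε => ?_⟩
  obtain ⟨N, hN⟩ := Metric.tendsto_atTop.1 ht ε hε
  refine ⟨N, fun n hn => (functionSystem_normLE_iff h1 hstar _ _).2 ⟨hε.le, fun x => ?_⟩⟩
  have h2 := (hN n hn).le
  rw [dist_eq_norm] at h2
  exact (ContinuousMap.norm_coe_le_norm ((s n).1 - t) x).trans h2

lemma isCommutative_functionSystem [T2Space X] :
    (functionSystem X V h1 hstar).IsCommutative :=
  ⟨X, inferInstance, inferInstance, inferInstance, V.subtype, rfl, fun _ _ => Iff.rfl⟩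

/-- Evaluation at a point, as a state of a function system. -/
def functionSystemEval (x : X) : (functionSystem X V h1 hstar).State :=
  ⟨fun f => f.1 x, fun _ _ => rfl, fun _ _ => rfl, rfl, fun _ _ hA => hA x⟩

end FunctionSystem

end States

section Colimits

open scoped ComplexOrder
open Matrix

variable {𝕜 : Type} [RCLike 𝕜]

lemma OSys.State.norm_le_norm {X : Type u} [TopologicalSpace X] [CompactSpace X]
    {V : Submodule 𝕜 C(X, 𝕜)} {h1 : 1 ∈ V} {hstar : ∀ f ∈ V, star f ∈ V}
    (x : (functionSystem X V h1 hstar).State) (f : V) : ‖x.1 f‖ ≤ ‖f.1‖ :=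
  x.norm_le ((functionSystem_normLE_iff h1 hstar f _).2
    ⟨norm_nonneg _, ContinuousMap.norm_coe_le_norm f.1⟩)

namespace OSys

variable {J : Type u} [SmallCategory J] (F : J ⥤ OSys.{u} 𝕜)

/-- The families of states on the objects of a diagram that are compatible with the
transition maps. -/
def limStateSet : Set (∀ j, (F.obj j).State) :=
  {x | ∀ (i j : J) (f : i ⟶ j), State.comap (F.map f) (x j) = x i}

/-- The limit of the state spaces of a diagram of operator systems. -/
abbrev LimState : Type u := limStateSet F

lemma isClosed_limStateSet : IsClosed (limStateSet F) := by
  simp only [limStateSet, Set.ofPred_forall]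
  exact isClosed_iInter fun i => isClosed_iInter fun j => isClosed_iInter fun f =>
    isClosed_eq ((State.continuous_comap _).comp (continuous_apply j)) (continuous_apply i)

instance : CompactSpace (LimState F) :=
  isCompact_iff_compactSpace.1 (isClosed_limStateSet F).isCompact

variable {F}

lemma LimState.apply_map (x : LimState F) {i j : J} (f : i ⟶ j) (s : (F.obj i).carrier) :
    (x.1 j).1 ((F.map f).toLin s) = (x.1 i).1 s :=
  congrFun (congrArg Subtype.val (x.2 i j f)) s

variable (F)

/-- Evaluation of compatible families of states at an element of `F.obj j`. -/
def evalLim (j : J) : (F.obj j).carrier →ₗ[𝕜] C(LimState F, 𝕜) where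
  toFun s := ⟨fun x => (x.1 j).1 s, (State.continuous_eval s).comp
    ((continuous_apply j).comp continuous_subtype_val)⟩
  map_add' a b := ContinuousMap.ext fun x => (x.1 j).map_add a b
  map_smul' c a := ContinuousMap.ext fun x => (x.1 j).map_smul c a

lemma evalLim_apply (j : J) (s : (F.obj j).carrier) (x : LimState F) :
    evalLim F j s x = (x.1 j).1 s := rfl

/-- The functions on the limit of the state spaces that come from elements of the diagram. -/
def colimSpan : Submodule 𝕜 C(LimState F, 𝕜) :=
  Submodule.span 𝕜 (insert 1 (⋃ j, Set.range (evalLim F j)))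

lemma star_mem_colimSpan {f : C(LimState F, 𝕜)} (hf : f ∈ colimSpan F) :
    star f ∈ colimSpan F := by
  induction hf using Submodule.span_induction with
  | mem f hf =>
    rcases hf with rfl | hf
    · rw [star_one]
      exact Submodule.subset_span (Set.mem_insert _ _)
    · obtain ⟨j, s, rfl⟩ := Set.mem_iUnion.1 hf
      refine Submodule.subset_span (Set.mem_insert_of_mem _ (Set.mem_iUnion.2 ⟨j, star s, ?_⟩))
      exact ContinuousMap.ext fun x => (x.1 j).map_star s
  | zero => rw [star_zero]; exact Submodule.zero_mem _
  | add f g _ _ hf hg => rw [star_add]; exact Submodule.add_mem _ hf hg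
  | smul c f _ hf => rw [star_smul]; exact Submodule.smul_mem _ _ hf

lemma one_mem_colimSpan_closure : 1 ∈ (colimSpan F).topologicalClosure :=
  Submodule.le_topologicalClosure _ (Submodule.subset_span (Set.mem_insert _ _))

lemma star_mem_colimSpan_closure (f : C(LimState F, 𝕜))
    (hf : f ∈ (colimSpan F).topologicalClosure) : star f ∈ (colimSpan F).topologicalClosure :=
  map_mem_closure continuous_star hf fun _ h => star_mem_colimSpan F h

/-- The operator system of uniform limits of functions on the limit of the state spaces of `F`
that come from elements of `F`. -/
noncomputable def colimSystem : OSys.{u} 𝕜 :=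
  functionSystem (LimState F) (colimSpan F).topologicalClosure (one_mem_colimSpan_closure F)
    (star_mem_colimSpan_closure F)

lemma isComplete_colimSystem : (colimSystem F).IsComplete :=
  isComplete_functionSystem (one_mem_colimSpan_closure F) (star_mem_colimSpan_closure F)
    (Submodule.isClosed_topologicalClosure _)

lemma isCommutative_colimSystem : (colimSystem F).IsCommutative :=
  isCommutative_functionSystem (one_mem_colimSpan_closure F) (star_mem_colimSpan_closure F)

lemma evalLim_mem (j : J) (s : (F.obj j).carrier) :
    evalLim F j s ∈ colimSpan F :=
  Submodule.subset_span (Set.mem_insert_of_mem _ (Set.mem_iUnion.2 ⟨j, s, rfl⟩))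

/-- The canonical morphism from `F.obj j` to `colimSystem F`. -/
noncomputable def toColimSystem (j : J) : F.obj j ⟶ colimSystem F where
  toLin := (evalLim F j).codRestrict (colimSpan F).topologicalClosure
    fun s => Submodule.le_topologicalClosure _ (evalLim_mem F j s)
  map_unit := Subtype.ext (ContinuousMap.ext fun x => (x.1 j).map_unit)
  map_mem hA := fun x => (x.1 j).posSemidef hA

lemma map_toColimSystem {i j : J} (f : i ⟶ j) :
    F.map f ≫ toColimSystem F j = toColimSystem F i :=
  OSys.hom_ext fun s => Subtype.ext (ContinuousMap.ext fun x => x.apply_map f s)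

variable {F}

lemma colimSystem_hom_ext {T : OSys.{u} 𝕜} (hT : T.StateDetermined) {φ ψ : colimSystem F ⟶ T}
    (h : ∀ j, toColimSystem F j ≫ φ = toColimSystem F j ≫ ψ) : φ = ψ := by
  have key : ∀ f (hf : f ∈ colimSpan F),
      φ.toLin ⟨f, Submodule.le_topologicalClosure _ hf⟩
        = ψ.toLin ⟨f, Submodule.le_topologicalClosure _ hf⟩ := by
    intro f hf
    induction hf using Submodule.span_induction with
    | mem f hf =>
      rcases hf with rfl | hf
      · exact φ.map_unit.trans ψ.map_unit.symm
      · obtain ⟨j, s, rfl⟩ := Set.mem_iUnion.1 hf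
        exact congrArg (fun χ : F.obj j ⟶ T => χ.toLin s) (h j)
    | zero => exact φ.toLin.map_zero.trans ψ.toLin.map_zero.symm
    | add f g hf hg h1 h2 =>
      have h3 := congrArg₂ (· + ·) h1 h2
      exact (φ.toLin.map_add _ _).trans (h3.trans (ψ.toLin.map_add _ _).symm)
    | smul c f hf h1 =>
      have h3 := congrArg (c • ·) h1
      exact (φ.toLin.map_smul _ _).trans (h3.trans (ψ.toLin.map_smul _ _).symm)
  refine hT.hom_ext fun f x => ?_
  obtain ⟨f, hf⟩ := f
  refine eq_of_forall_dist_le fun ε hε => ?_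
  obtain ⟨g, hg, hfg⟩ := Metric.mem_closure_iff.1 hf (ε / 2) (by positivity)
  rw [dist_eq_norm] at hfg
  let f' : (colimSystem F).carrier := ⟨f, hf⟩
  let g' : (colimSystem F).carrier := ⟨g, Submodule.le_topologicalClosure _ hg⟩
  have h1 := (State.norm_le_norm (hstar := star_mem_colimSpan_closure F)
    (State.comap φ x) (f' - g')).trans hfg.le
  have h2 := (State.norm_le_norm (hstar := star_mem_colimSpan_closure F)
    (State.comap ψ x) (f' - g')).trans hfg.le
  have e1 := State.map_sub (State.comap φ x) f' g'
  have e2 := State.map_sub (State.comap ψ x) f' g'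
  have e3 : (State.comap φ x).1 g' = (State.comap ψ x).1 g' := congrArg x.1 (key g hg)
  have e4 : (State.comap φ x).1 f' - (State.comap ψ x).1 f'
      = (State.comap φ x).1 (f' - g') - (State.comap ψ x).1 (f' - g') := by
    refine Eq.trans ?_ (congrArg₂ (· - ·) e1 e2).symm
    rw [e3]; ring
  change dist ((State.comap φ x).1 f') ((State.comap ψ x).1 f') ≤ ε
  rw [dist_eq_norm, e4]
  refine (norm_sub_le _ _).trans ((add_le_add h1 h2).trans (by linarith))

lemma exists_colimSystem_desc {T : OSys.{u} 𝕜} (hT : T.StateDetermined) (hc : T.IsComplete)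
    (t : ∀ j, F.obj j ⟶ T) (ht : ∀ (i j : J) (f : i ⟶ j), F.map f ≫ t j = t i) :
    ∃ φ : colimSystem F ⟶ T, ∀ j, toColimSystem F j ≫ φ = t j := by
  let p : C(T.State, LimState F) :=
    ⟨fun x => ⟨fun j => State.comap (t j) x, fun i j f => by dsimp only; rw [← ht i j f]; rfl⟩,
      Continuous.subtype_mk (continuous_pi fun j => State.continuous_comap (t j)) _⟩
  obtain ⟨φ, hφ⟩ := exists_hom_of_stateMap (S := colimSystem F) hT
    (fun x => functionSystemEval (one_mem_colimSpan_closure F) (star_mem_colimSpan_closure F)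
      (p x)) fun f => by
      refine exists_forall_eq_of_mem_closure hT hc (f := f.1.comp p) ?_
      refine map_mem_closure (f := fun g : C(LimState F, 𝕜) => g.comp p)
        (ContinuousMap.continuous_precomp p) f.2 fun g hg => ?_
      change g.comp p ∈ LinearMap.range T.evalState
      induction hg using Submodule.span_induction with
      | mem f hf =>
        rcases hf with rfl | hf
        · exact ⟨T.unit, ContinuousMap.ext fun x => x.map_unit⟩
        · obtain ⟨j, s, rfl⟩ := Set.mem_iUnion.1 hf
          exact ⟨(t j).toLin s, rfl⟩
      | zero => exact Submodule.zero_mem _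
      | add f g hf hg h1 h2 => exact Submodule.add_mem _ h1 h2
      | smul c f hf h1 => exact Submodule.smul_mem _ c h1
  exact ⟨φ, fun j => hT.hom_ext fun s x => hφ _ x⟩

end OSys

namespace OSysC

open OSys

lemma stateDetermined (T : OSysC.{u} 𝕜) : T.obj.StateDetermined := T.property.2.stateDetermined

/-- `colimSystem F` as a complete commutative operator system. -/
noncomputable def colim {J : Type u} [SmallCategory J] (F : J ⥤ OSys.{u} 𝕜) : OSysC.{u} 𝕜 :=
  ⟨colimSystem F, isComplete_colimSystem F, isCommutative_colimSystem F⟩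

theorem isRightAdjoint_inclusion : (OSysC.inclusion.{u} 𝕜).IsRightAdjoint := by
  rw [isRightAdjoint_iff_hasInitial_structuredArrow]
  intro S
  let F : Discrete PUnit.{u + 1} ⥤ OSys.{u} 𝕜 := (Functor.const _).obj S
  let j : Discrete PUnit.{u + 1} := ⟨⟨⟩⟩
  have h : ∀ T : StructuredArrow S (OSysC.inclusion.{u} 𝕜), ∃ φ : colimSystem F ⟶ T.right.obj,
      ∀ j, toColimSystem F j ≫ φ = T.hom := fun T =>
    exists_colimSystem_desc (F := F) T.right.stateDetermined T.right.property.1 (fun _ => T.hom)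
      fun _ _ _ => Category.id_comp _
  choose φ hφ using h
  refine (IsInitial.ofUniqueHom
    (X := StructuredArrow.mk (S := S) (T := OSysC.inclusion.{u} 𝕜) (Y := colim F)
      (toColimSystem F j))
    (fun T => StructuredArrow.homMk (ObjectProperty.homMk (φ T)) (hφ T j))
    fun T m => ?_).hasInitial
  refine StructuredArrow.hom_ext _ _ (ObjectProperty.hom_ext _ ?_)
  refine colimSystem_hom_ext T.right.stateDetermined fun k => ?_
  exact (StructuredArrow.w m).trans (hφ T k).symm

variable {J : Type u} [SmallCategory J] (F : J ⥤ OSysC.{u} 𝕜)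

/-- The canonical cocone on a diagram of complete commutative operator systems. -/
noncomputable def colimCocone : Cocone F where
  pt := colim (F ⋙ OSysC.inclusion 𝕜)
  ι :=
    { app := fun j => ObjectProperty.homMk (toColimSystem (F ⋙ OSysC.inclusion 𝕜) j)
      naturality := fun _ _ f => ObjectProperty.hom_ext _
        (map_toColimSystem (F ⋙ OSysC.inclusion 𝕜) f) }

/-- `colimCocone F` is a colimit cocone. -/
noncomputable def isColimitColimCocone : IsColimit (colimCocone F) := by
  have h : ∀ s : Cocone F, ∃ φ : colimSystem (F ⋙ OSysC.inclusion 𝕜) ⟶ s.pt.obj,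
      ∀ j, toColimSystem (F ⋙ OSysC.inclusion 𝕜) j ≫ φ = (s.ι.app j).hom := fun s =>
    exists_colimSystem_desc (F := F ⋙ OSysC.inclusion 𝕜) s.pt.stateDetermined s.pt.property.1
      (fun j => (s.ι.app j).hom)
      fun i j f => congrArg (fun χ => χ.hom) (s.w f)
  choose φ hφ using h
  refine
    { desc := fun s => ObjectProperty.homMk (φ s)
      fac := fun s j => ObjectProperty.hom_ext _ (hφ s j)
      uniq := fun s m hm => ObjectProperty.hom_ext _ ?_ }
  refine colimSystem_hom_ext s.pt.stateDetermined fun j => ?_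
  exact (congrArg (fun χ => χ.hom) (hm j)).trans (hφ s j).symm

instance hasColimits : HasColimits (OSysC.{u} 𝕜) :=
  ⟨fun _ _ => ⟨fun F => ⟨⟨_, isColimitColimCocone F⟩⟩⟩⟩

end OSysC

end Colimits

section LimitsOfSystems

open scoped ComplexOrder
open Matrix OSys

variable {𝕜 : Type} [RCLike 𝕜]

namespace OSysC

variable {J : Type u} [SmallCategory J] (F : J ⥤ OSysC.{u} 𝕜)

/-- The Stone–Čech compactification of the disjoint union of the state spaces of a diagram. -/
abbrev LimSpace : Type u := StoneCech (Σ j, (F.obj j).obj.State)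

/-- The inclusion of a state space into `LimSpace F`. -/
def toLimSpace (j : J) : C((F.obj j).obj.State, LimSpace F) :=
  ⟨fun x => stoneCechUnit ⟨j, x⟩, continuous_stoneCechUnit.comp continuous_sigmaMk⟩

/-- The functions on `LimSpace F` that come from compatible families of elements of `F`. -/
def limFunctions : Submodule 𝕜 C(LimSpace F, 𝕜) where
  carrier := {f | (∀ j, f.comp (toLimSpace F j) ∈ LinearMap.range (F.obj j).obj.evalState) ∧
    ∀ (i j : J) (a : i ⟶ j) (x : (F.obj j).obj.State),
      f (toLimSpace F i (State.comap (F.map a).hom x)) = f (toLimSpace F j x)}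
  add_mem' hf hg := ⟨fun j => Submodule.add_mem _ (hf.1 j) (hg.1 j), fun i j a x =>
    congrArg₂ (· + ·) (hf.2 i j a x) (hg.2 i j a x)⟩
  zero_mem' := ⟨fun _ => Submodule.zero_mem _, fun _ _ _ _ => rfl⟩
  smul_mem' c _ hf := ⟨fun j => Submodule.smul_mem _ c (hf.1 j), fun i j a x =>
    congrArg (c • ·) (hf.2 i j a x)⟩

lemma one_mem_limFunctions : 1 ∈ limFunctions F :=
  ⟨fun j => ⟨(F.obj j).obj.unit, ContinuousMap.ext fun x => x.map_unit⟩, fun _ _ _ _ => rfl⟩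

lemma star_mem_limFunctions (f : C(LimSpace F, 𝕜)) (hf : f ∈ limFunctions F) :
    star f ∈ limFunctions F := by
  refine ⟨fun j => ?_, fun i j a x => congrArg star (hf.2 i j a x)⟩
  obtain ⟨s, hs⟩ := hf.1 j
  refine ⟨star s, ContinuousMap.ext fun x => ?_⟩
  exact (x.map_star s).trans (congrArg (fun g => star (g x)) hs)

lemma isClosed_limFunctions : IsClosed (limFunctions F : Set C(LimSpace F, 𝕜)) := by
  have : (limFunctions F : Set C(LimSpace F, 𝕜)) =
      (⋂ j, (fun f => f.comp (toLimSpace F j)) ⁻¹' Set.range (F.obj j).obj.evalState) ∩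
      ⋂ (i) (j) (a : i ⟶ j) (x : (F.obj j).obj.State),
        {f | f (toLimSpace F i (State.comap (F.map a).hom x)) = f (toLimSpace F j x)} := by
    ext f
    simp only [Set.mem_inter_iff, Set.mem_iInter]
    rfl
  rw [this]
  refine IsClosed.inter (isClosed_iInter fun j => ?_) (isClosed_iInter fun i =>
    isClosed_iInter fun j => isClosed_iInter fun a => isClosed_iInter fun x => ?_)
  · exact (isClosed_range_evalState (F.obj j).stateDetermined (F.obj j).property.1).preimage
      (ContinuousMap.continuous_precomp _)
  · exact isClosed_eq (continuous_eval_const _) (continuous_eval_const _)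

/-- The limit of a diagram of complete commutative operator systems. -/
noncomputable def lim : OSysC.{u} 𝕜 :=
  ⟨functionSystem (LimSpace F) (limFunctions F) (one_mem_limFunctions F) (star_mem_limFunctions F),
    isComplete_functionSystem _ _ (isClosed_limFunctions F), isCommutative_functionSystem _ _⟩

/-- The state of `lim F` given by a state of an object of the diagram. -/
noncomputable def limState (j : J) (x : (F.obj j).obj.State) : (lim F).obj.State :=
  functionSystemEval (one_mem_limFunctions F) (star_mem_limFunctions F) (toLimSpace F j x)

lemma exists_limProj (j : J) : ∃ φ : (lim F).obj ⟶ (F.obj j).obj,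
    ∀ f (x : (F.obj j).obj.State), x.1 (φ.toLin f) = (limState F j x).1 f :=
  exists_hom_of_stateMap (F.obj j).stateDetermined (limState F j) fun f => by
    obtain ⟨s, hs⟩ := f.2.1 j
    exact ⟨s, fun x => congrArg (fun g => g x) hs⟩

/-- The limit cone over a diagram of complete commutative operator systems. -/
noncomputable def limCone : Cone F where
  pt := lim F
  π :=
    { app := fun j => ObjectProperty.homMk (exists_limProj F j).choose
      naturality := fun i j a => by
        refine ObjectProperty.hom_ext _ ((F.obj j).stateDetermined.hom_ext fun f x => ?_)
        refine ((exists_limProj F j).choose_spec f x).trans ?_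
        refine Eq.trans ?_ ((exists_limProj F i).choose_spec f (State.comap (F.map a).hom x)).symm
        exact (f.2.2 i j a x).symm }

lemma limCone_apply (j : J) (f : (lim F).obj.carrier) (x : (F.obj j).obj.State) :
    x.1 (((limCone F).π.app j).hom.toLin f) = (limState F j x).1 f :=
  (exists_limProj F j).choose_spec f x

lemma continuous_comap_cone (s : Cone F) :
    Continuous fun p : Σ j, (F.obj j).obj.State =>
      (State.comap (S := s.pt.obj) (s.π.app p.1).hom p.2 : s.pt.obj.State) :=
  continuous_sigma fun j => State.continuous_comap (S := s.pt.obj) (s.π.app j).hom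

/-- The map from `LimSpace F` to the state space of the apex of a cone. -/
noncomputable def limSpaceDesc (s : Cone F) : C(LimSpace F, s.pt.obj.State) :=
  ⟨stoneCechExtend (continuous_comap_cone F s), continuous_stoneCechExtend _⟩

lemma limSpaceDesc_apply (s : Cone F) (j : J) (x : (F.obj j).obj.State) :
    limSpaceDesc F s (toLimSpace F j x) = State.comap (S := s.pt.obj) (s.π.app j).hom x :=
  stoneCechExtend_stoneCechUnit (continuous_comap_cone F s) ⟨j, x⟩

lemma comp_limSpaceDesc_mem (s : Cone F) (t : s.pt.obj.carrier) :
    (s.pt.obj.evalState t).comp (limSpaceDesc F s) ∈ limFunctions F := by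
  have h : ∀ (j : J) (x : (F.obj j).obj.State),
      (s.pt.obj.evalState t).comp (limSpaceDesc F s) (toLimSpace F j x)
        = x.1 ((s.π.app j).hom.toLin t) := fun j x =>
    congrArg (fun y : s.pt.obj.State => y.1 t) (limSpaceDesc_apply F s j x)
  refine ⟨fun j => ⟨(s.π.app j).hom.toLin t, ContinuousMap.ext fun x => (h j x).symm⟩,
    fun i j a x => ?_⟩
  rw [h, h, ← s.w a]
  rfl

/-- `limCone F` is a limit cone. -/
noncomputable def isLimitLimCone : IsLimit (limCone F) where
  lift s := ObjectProperty.homMk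
    { toLin :=
        { toFun := fun t => ⟨_, comp_limSpaceDesc_mem F s t⟩
          map_add' := fun a b => Subtype.ext (ContinuousMap.ext fun p =>
            (limSpaceDesc F s p).map_add a b)
          map_smul' := fun c a => Subtype.ext (ContinuousMap.ext fun p =>
            (limSpaceDesc F s p).map_smul c a) }
      map_unit := Subtype.ext (ContinuousMap.ext fun p => (limSpaceDesc F s p).map_unit)
      map_mem := fun hA p => (limSpaceDesc F s p).posSemidef hA }
  fac s j := by
    refine ObjectProperty.hom_ext _ ((F.obj j).stateDetermined.hom_ext fun t x => ?_)
    refine (limCone_apply F j _ x).trans ?_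
    exact congrArg (fun y : s.pt.obj.State => y.1 t) (limSpaceDesc_apply F s j x)
  uniq s m hm := by
    refine ObjectProperty.hom_ext _ (OSys.hom_ext fun t => Subtype.ext (ContinuousMap.ext fun p =>
      congrFun (DenseRange.equalizer denseRange_stoneCechUnit
        (ContinuousMap.continuous _) (ContinuousMap.continuous _) (funext fun q => ?_)) p))
    obtain ⟨j, x⟩ := q
    refine (limCone_apply F j (m.hom.toLin t) x).symm.trans ?_
    refine Eq.trans ?_ (congrArg (fun y : s.pt.obj.State => y.1 t)
      (limSpaceDesc_apply F s j x)).symm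
    exact congrArg (fun χ : s.pt ⟶ F.obj j => x.1 (χ.hom.toLin t)) (hm j)

theorem hasLimits : HasLimits (OSysC.{u} 𝕜) :=
  ⟨fun _ _ => ⟨fun F => ⟨⟨_, isLimitLimCone F⟩⟩⟩⟩

end OSysC

end LimitsOfSystems

section FilteredColimits

open scoped ComplexOrder
open Matrix

variable {𝕜 : Type} [RCLike 𝕜]

lemma hasCardinalLT_aleph_one_of_countable (ι : Type*) [Countable ι] :
    HasCardinalLT ι (Cardinal.aleph 1 : Cardinal.{u}) := by
  rw [HasCardinalLT, Cardinal.lift_aleph]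
  refine lt_of_le_of_lt (Cardinal.lift_le_aleph0.2 Cardinal.mk_le_aleph0) ?_
  simp

namespace OSys

lemma State.map_quadraticForm {S : OSys.{u} 𝕜} (x : S.State) {n : ℕ} (v : Fin n → 𝕜)
    (A : Matrix (Fin n) (Fin n) S.carrier) :
    x.1 (∑ p, ∑ q, (star (v p) * v q) • A p q) = star v ⬝ᵥ (A.map x.1) *ᵥ v := by
  simp only [x.map_sum, x.map_smul, dotProduct, mulVec, Finset.mul_sum, Pi.star_apply, map_apply]
  exact Finset.sum_congr rfl fun p _ => Finset.sum_congr rfl fun q _ => by ring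

variable {J : Type u} [SmallCategory J] {F : J ⥤ OSys.{u} 𝕜}

lemma State.comap_comp {S T U : OSys.{u} 𝕜} (f : S ⟶ T) (g : T ⟶ U) (x : U.State) :
    State.comap f (State.comap g x) = State.comap (f ≫ g) x := rfl

lemma map_comp_toLin {i j k : J} (f : i ⟶ j) (g : j ⟶ k) (s : (F.obj i).carrier) :
    (F.map (f ≫ g)).toLin s = (F.map g).toLin ((F.map f).toLin s) := by
  rw [F.map_comp]; rfl

/-- If an element is nonnegative on the limit of the state spaces, it is almost nonnegative on
some state space. -/
lemma exists_map_forall_neg_lt [IsFiltered J] {j : J} (a : (F.obj j).carrier)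
    (h : ∀ x : LimState F, 0 ≤ RCLike.re ((x.1 j).1 a)) {ε : ℝ} (hε : 0 < ε) :
    ∃ (k : J) (f : j ⟶ k), ∀ y : (F.obj k).State,
      -ε < RCLike.re (y.1 ((F.map f).toLin a)) := by
  classical
  by_contra! H
  have hne : ∀ i, Nonempty (F.obj i).State := fun i =>
    let ⟨y, _⟩ := H (IsFiltered.max i j) (IsFiltered.rightToMax i j)
    ⟨State.comap (F.map (IsFiltered.leftToMax i j)) y⟩
  let C : (Σ p : J × J, p.1 ⟶ p.2) → Set (∀ i, (F.obj i).State) := fun f =>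
    {x | State.comap (F.map f.2) (x f.1.2) = x f.1.1}
  have hC : ∀ f, IsClosed (C f) := fun f =>
    isClosed_eq ((State.continuous_comap _).comp (continuous_apply _)) (continuous_apply _)
  have hC0 : IsCompact {x : ∀ i, (F.obj i).State | RCLike.re ((x j).1 a) ≤ -ε} :=
    (isClosed_le (RCLike.continuous_re.comp ((State.continuous_eval a).comp (continuous_apply j)))
      continuous_const).isCompact
  obtain ⟨x, hx0, hx⟩ := hC0.inter_iInter_nonempty C hC fun u => by
    let O : Finset J := insert j (u.image (fun f => f.1.1) ∪ u.image (fun f => f.1.2))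
    have hO1 : ∀ f ∈ u, f.1.1 ∈ O := fun f hf => Finset.mem_insert_of_mem
      (Finset.mem_union_left _ (Finset.mem_image_of_mem (fun f => f.1.1) hf))
    have hO2 : ∀ f ∈ u, f.1.2 ∈ O := fun f hf => Finset.mem_insert_of_mem
      (Finset.mem_union_right _ (Finset.mem_image_of_mem (fun f => f.1.2) hf))
    let e : {f // f ∈ u} → Σ' (X Y : J) (_ : X ∈ O) (_ : Y ∈ O), X ⟶ Y := fun f =>
      ⟨f.1.1.1, f.1.1.2, hO1 f.1 f.2, hO2 f.1 f.2, f.1.2⟩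
    obtain ⟨k, T, hT⟩ := IsFiltered.sup_exists O (u.attach.image e)
    have hj : j ∈ O := Finset.mem_insert_self _ _
    obtain ⟨y, hy⟩ := H k (T hj)
    let x : ∀ i, (F.obj i).State := fun i =>
      if hi : i ∈ O then State.comap (F.map (T hi)) y else (hne i).some
    have hx : ∀ i (hi : i ∈ O), x i = State.comap (F.map (T hi)) y := fun i hi => dif_pos hi
    refine ⟨x, ?_, Set.mem_iInter₂.2 fun f hf => ?_⟩
    · change RCLike.re ((x j).1 a) ≤ -ε
      rw [hx j hj]
      exact hy
    · change State.comap (F.map f.2) (x f.1.2) = x f.1.1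
      rw [hx _ (hO1 f hf), hx _ (hO2 f hf), State.comap_comp, ← F.map_comp, hT]
      exact Finset.mem_image.2 ⟨⟨f, hf⟩, Finset.mem_attach _ _, rfl⟩
  have hx' : x ∈ limStateSet F := fun i i' f => Set.mem_iInter.1 hx ⟨(i, i'), f⟩
  have h1 : RCLike.re ((x j).1 a) ≤ -ε := hx0
  linarith [h ⟨x, hx'⟩]

variable [IsCardinalFiltered J (Cardinal.aleph 1 : Cardinal.{u})]

lemma exists_map_forall_nonneg {j : J} {ι : Type} [Countable ι]
    (a : ι → (F.obj j).carrier) (h : ∀ i (x : LimState F), 0 ≤ RCLike.re ((x.1 j).1 (a i))) :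
    ∃ (k : J) (f : j ⟶ k), ∀ i (y : (F.obj k).State),
      0 ≤ RCLike.re (y.1 ((F.map f).toLin (a i))) := by
  have := isFiltered_of_isCardinalFiltered J (Cardinal.aleph 1 : Cardinal.{u})
  choose k f hf using fun p : ι × ℕ =>
    exists_map_forall_neg_lt (a p.1) (h p.1) (Nat.one_div_pos_of_nat (α := ℝ) (n := p.2))
  obtain ⟨m, b, c, hbc⟩ := IsCardinalFiltered.wideSpan (κ := (Cardinal.aleph 1 : Cardinal.{u})) f
    (hasCardinalLT_aleph_one_of_countable _)
  refine ⟨m, c, fun i y => ?_⟩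
  by_contra! hneg
  obtain ⟨N, hN⟩ := exists_nat_one_div_lt (neg_pos.2 hneg)
  have h1 := hf (i, N) (State.comap (F.map (b (i, N))) y)
  rw [State.comap_apply, ← map_comp_toLin, hbc] at h1
  linarith

/-- A matrix that is positive on the limit of the state spaces is positive at some stage. -/
lemma exists_map_mem_cone (hF : ∀ j, (F.obj j).StateDetermined) {j : J} {n : ℕ}
    (A : Matrix (Fin n) (Fin n) (F.obj j).carrier)
    (h : ∀ x : LimState F, (A.map (x.1 j).1).PosSemidef) :
    ∃ (k : J) (f : j ⟶ k), A.map (F.map f).toLin ∈ (F.obj k).cone n := by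
  let c := TopologicalSpace.denseSeq 𝕜
  let v := TopologicalSpace.denseSeq (Fin n → 𝕜)
  let a : (ℕ × Fin n × Fin n) ⊕ ℕ → (F.obj j).carrier := Sum.elim
    (fun q => c q.1 • (A q.2.1 q.2.2 - star (A q.2.2 q.2.1)))
    (fun m => ∑ p, ∑ q, (star (v m p) * v m q) • A p q)
  obtain ⟨k, f, hf⟩ := exists_map_forall_nonneg a (by
    rintro (⟨m, p, q⟩ | m) x
    · have := (h x).1.apply p q
      simp only [map_apply] at this
      simp only [a, Sum.elim_inl, State.map_smul, State.map_sub, State.map_star, this, sub_self,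
        mul_zero, map_zero, le_refl]
    · simp only [a, Sum.elim_inr, State.map_quadraticForm]
      exact (posSemidef_iff_re.1 (h x)).2 _)
  refine ⟨k, f, hF k n _ fun y => ?_⟩
  let z := State.comap (F.map f) y
  change (A.map z.1).PosSemidef
  refine posSemidef_of_re (IsHermitian.ext fun p q => ?_) fun w => ?_
  · have h1 : ∀ b : 𝕜, 0 ≤ RCLike.re (b * (z.1 (A p q) - star (z.1 (A q p)))) := fun b => by
      refine (TopologicalSpace.denseRange_denseSeq 𝕜).induction_on
        (p := fun b => 0 ≤ RCLike.re (b * (z.1 (A p q) - star (z.1 (A q p))))) b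
        (isClosed_le continuous_const (by fun_prop)) fun m => ?_
      have h2 : 0 ≤ RCLike.re (z.1 (a (Sum.inl (m, p, q)))) := hf (Sum.inl (m, p, q)) y
      simpa only [a, Sum.elim_inl, State.map_smul, State.map_sub, State.map_star] using h2
    have h3 := h1 (-star (z.1 (A p q) - star (z.1 (A q p))))
    rw [neg_mul, RCLike.star_def, RCLike.conj_mul, map_neg, ← RCLike.ofReal_pow,
      RCLike.ofReal_re] at h3
    have h4 : ‖z.1 (A p q) - star (z.1 (A q p))‖ = 0 := by
      rw [RCLike.star_def]
      nlinarith [norm_nonneg (z.1 (A p q) - (starRingEnd 𝕜) (z.1 (A q p)))]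
    exact (sub_eq_zero.1 (norm_eq_zero.1 h4)).symm
  · refine (TopologicalSpace.denseRange_denseSeq (Fin n → 𝕜)).induction_on
      (p := fun w => 0 ≤ RCLike.re (star w ⬝ᵥ (A.map z.1) *ᵥ w)) w
      (isClosed_le continuous_const (RCLike.continuous_re.comp
        (continuous_star.dotProduct (continuous_const.matrix_mulVec continuous_id)))) fun m => ?_
    have h2 : 0 ≤ RCLike.re (z.1 (a (Sum.inr m))) := hf (Sum.inr m) y
    simpa only [a, Sum.elim_inr, State.map_quadraticForm] using h2

lemma exists_normLE_map (hF : ∀ j, (F.obj j).StateDetermined) {j : J} (s : (F.obj j).carrier)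
    {r : ℝ} (hr : 0 ≤ r) (h : ∀ x : LimState F, ‖(x.1 j).1 s‖ ≤ r) :
    ∃ (k : J) (f : j ⟶ k), (F.obj k).NormLE ((F.map f).toLin s) r := by
  obtain ⟨k, f, hf⟩ := exists_map_mem_cone hF
    !![(r : 𝕜) • (F.obj j).unit, s; star s, (r : 𝕜) • (F.obj j).unit] fun x => by
      convert (posSemidef_two_iff hr).2 ⟨rfl, h x⟩ using 1
      ext p q
      fin_cases p <;> fin_cases q <;> simp [State.map_smul, State.map_unit, State.map_star]
  refine ⟨k, f, (hF k).normLE hr fun y => ?_⟩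
  refine ((posSemidef_two_iff (b := y.1 ((F.map f).toLin (star s))) hr).1 ?_).2
  convert y.posSemidef hf using 1
  ext p q
  fin_cases p <;> fin_cases q <;> simp [State.map_smul, State.map_unit, (F.map f).map_unit]

lemma exists_evalLim_eq_of_mem_span {f : C(LimState F, 𝕜)} (hf : f ∈ colimSpan F) :
    ∃ (j : J) (s : (F.obj j).carrier), evalLim F j s = f := by
  have := isFiltered_of_isCardinalFiltered J (Cardinal.aleph 1 : Cardinal.{u})
  have hmap : ∀ {i j : J} (g : i ⟶ j) (s : (F.obj i).carrier),
      evalLim F j ((F.map g).toLin s) = evalLim F i s := fun g s =>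
    ContinuousMap.ext fun x => x.apply_map g s
  induction hf using Submodule.span_induction with
  | mem f hf =>
    rcases hf with rfl | hf
    · obtain ⟨j⟩ : Nonempty J := IsFiltered.nonempty
      exact ⟨j, (F.obj j).unit, ContinuousMap.ext fun x => (x.1 j).map_unit⟩
    · obtain ⟨j, s, rfl⟩ := Set.mem_iUnion.1 hf
      exact ⟨j, s, rfl⟩
  | zero =>
    obtain ⟨j⟩ : Nonempty J := IsFiltered.nonempty
    exact ⟨j, 0, map_zero _⟩
  | add f g _ _ hf hg =>
    obtain ⟨i, s, rfl⟩ := hf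
    obtain ⟨j, t, rfl⟩ := hg
    exact ⟨IsFiltered.max i j, (F.map (IsFiltered.leftToMax i j)).toLin s
      + (F.map (IsFiltered.rightToMax i j)).toLin t, by rw [map_add, hmap, hmap]⟩
  | smul c f _ hf =>
    obtain ⟨i, s, rfl⟩ := hf
    exact ⟨i, c • s, map_smul _ _ _⟩

/-- Every element of `colimSystem F` comes from the diagram. -/
lemma exists_evalLim_eq (hF : ∀ j, (F.obj j).StateDetermined) (hc : ∀ j, (F.obj j).IsComplete)
    {f : C(LimState F, 𝕜)} (hf : f ∈ (colimSpan F).topologicalClosure) :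
    ∃ (j : J) (s : (F.obj j).carrier), evalLim F j s = f := by
  have h1 : ∀ m : ℕ, ∃ (j : J) (s : (F.obj j).carrier),
      ‖f - evalLim F j s‖ ≤ 1 / ((m : ℝ) + 1) := fun m => by
    obtain ⟨g, hg, hfg⟩ := Metric.mem_closure_iff.1 hf _ (Nat.one_div_pos_of_nat (α := ℝ) (n := m))
    obtain ⟨j, s, rfl⟩ := exists_evalLim_eq_of_mem_span hg
    exact ⟨j, s, by rw [← dist_eq_norm]; exact hfg.le⟩
  choose i t ht using h1
  let κ : Cardinal.{u} := Cardinal.aleph 1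
  let j : J := IsCardinalFiltered.max (κ := κ) i (hasCardinalLT_aleph_one_of_countable _)
  let s : ℕ → (F.obj j).carrier := fun m =>
    (F.map (IsCardinalFiltered.toMax (κ := κ) i (hasCardinalLT_aleph_one_of_countable _) m)).toLin
      (t m)
  have hs : ∀ m (x : LimState F), ‖f x - (x.1 j).1 (s m)‖ ≤ 1 / ((m : ℝ) + 1) := fun m x => by
    rw [x.apply_map]
    exact (ContinuousMap.norm_coe_le_norm (f - evalLim F (i m) (t m)) x).trans (ht m)
  have h2 : ∀ p : ℕ × ℕ, ∃ (k : J) (g : j ⟶ k), (F.obj k).NormLE ((F.map g).toLin (s p.1 - s p.2))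
      (1 / ((p.1 : ℝ) + 1) + 1 / ((p.2 : ℝ) + 1)) := fun p => by
    refine exists_normLE_map hF _ (by positivity) fun x => ?_
    have e : (x.1 j).1 (s p.1 - s p.2)
        = (f x - (x.1 j).1 (s p.2)) - (f x - (x.1 j).1 (s p.1)) := by
      rw [State.map_sub]; ring
    rw [e]
    refine (norm_sub_le _ _).trans ?_
    linarith [hs p.1 x, hs p.2 x]
  choose k g hg using h2
  obtain ⟨l, b, c, hbc⟩ := IsCardinalFiltered.wideSpan (κ := κ) g
    (hasCardinalLT_aleph_one_of_countable _)
  obtain ⟨w, hw⟩ := hc l (fun m => (F.map c).toLin (s m)) fun ε hε => by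
    obtain ⟨N, hN⟩ := exists_nat_one_div_lt (half_pos hε)
    refine ⟨N, fun m n hm hn => (hF l).normLE hε.le fun y => ?_⟩
    have h3 := State.norm_le (State.comap (F.map (b (m, n))) y) (hg (m, n))
    rw [State.comap_apply, ← map_comp_toLin, hbc, map_sub] at h3
    have h4 := Nat.one_div_le_one_div (α := ℝ) hm
    have h5 := Nat.one_div_le_one_div (α := ℝ) hn
    simp only at h3
    linarith
  refine ⟨l, w, ContinuousMap.ext fun x => eq_of_forall_dist_le fun ε hε => ?_⟩
  obtain ⟨N, hN⟩ := hw (ε / 2) (half_pos hε)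
  obtain ⟨M, hM⟩ := exists_nat_one_div_lt (half_pos hε)
  have h6 := State.norm_le (x.1 l) (hN (max N M) (le_max_left _ _))
  have h7 := hs (max N M) x
  have h8 := Nat.one_div_le_one_div (α := ℝ) (le_max_right N M)
  rw [State.map_sub, x.apply_map] at h6
  rw [dist_comm, dist_eq_norm, evalLim_apply]
  calc ‖f x - (x.1 l).1 w‖
      = ‖(f x - (x.1 j).1 (s (max N M))) + ((x.1 j).1 (s (max N M)) - (x.1 l).1 w)‖ := by
        congr 1; ring
    _ ≤ _ := norm_add_le _ _
    _ ≤ ε := by linarith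

end OSys

end FilteredColimits

section Accessibility

open scoped ComplexOrder
open Matrix

variable {𝕜 : Type} [RCLike 𝕜]

namespace OSys

/-- The map of the diagram of a cocone into its apex is, at the level of underlying sets and of
positive matrices, a filtered colimit. -/
structure IsAlgebraicColimit {J : Type u} [SmallCategory J] {F : J ⥤ OSys.{u} 𝕜}
    (c : Cocone F) : Prop where
  exists_rep (t : c.pt.carrier) :
    ∃ (j : J) (s : (F.obj j).carrier), Hom.toLin (c.ι.app j) s = t
  exists_map_mem_cone {n : ℕ} {j : J} (A : Matrix (Fin n) (Fin n) (F.obj j).carrier) :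
    A.map (Hom.toLin (c.ι.app j)) ∈ c.pt.cone n →
      ∃ (k : J) (f : j ⟶ k), A.map (F.map f).toLin ∈ (F.obj k).cone n

lemma eq_zero_of_mem_cone_one {S : OSys.{u} 𝕜} {s : S.carrier}
    (h : (!![s] : Matrix (Fin 1) (Fin 1) S.carrier) ∈ S.cone 1)
    (h' : (!![-s] : Matrix (Fin 1) (Fin 1) S.carrier) ∈ S.cone 1) : s = 0 := by
  have e : -(!![s] : Matrix (Fin 1) (Fin 1) S.carrier) = !![-s] := by ext i j; simp
  have h0 : (!![s] : Matrix (Fin 1) (Fin 1) S.carrier) = 0 :=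
    OperatorSystem.eq_zero_of_mem_of_neg_mem (𝕜 := 𝕜) h (by rw [e]; exact h')
  simpa using congrFun (congrFun h0 0) 0

lemma map_mem_cone_one {S T : OSys.{u} 𝕜} (f : S ⟶ T) {s : S.carrier}
    (h : (!![s] : Matrix (Fin 1) (Fin 1) S.carrier) ∈ S.cone 1) :
    (!![f.toLin s] : Matrix (Fin 1) (Fin 1) T.carrier) ∈ T.cone 1 := by
  have e : (!![f.toLin s] : Matrix (Fin 1) (Fin 1) T.carrier) = (!![s]).map f.toLin := by
    ext i j; simp
  rw [e]
  exact f.map_mem h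

lemma zero_mem_cone_one {S : OSys.{u} 𝕜} :
    (!![0] : Matrix (Fin 1) (Fin 1) S.carrier) ∈ S.cone 1 := by
  have e : (!![0] : Matrix (Fin 1) (Fin 1) S.carrier) = 0 := by ext i j; simp
  rw [e]
  exact OperatorSystem.zero_mem (𝕜 := 𝕜) 1

namespace IsAlgebraicColimit

variable {J : Type u} [SmallCategory J] {F : J ⥤ OSys.{u} 𝕜} {c : Cocone F}

lemma ι_map (c : Cocone F) {i j : J} (f : i ⟶ j) (s : (F.obj i).carrier) :
    Hom.toLin (c.ι.app j) ((F.map f).toLin s) = Hom.toLin (c.ι.app i) s :=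
  congrArg (fun χ : F.obj i ⟶ c.pt => χ.toLin s) (c.w f)

lemma exists_map_mem_cone_one (hc : IsAlgebraicColimit c) {j : J} (s : (F.obj j).carrier)
    (h : (!![Hom.toLin (c.ι.app j) s] : Matrix (Fin 1) (Fin 1) c.pt.carrier) ∈ c.pt.cone 1) :
    ∃ (k : J) (f : j ⟶ k),
      (!![(F.map f).toLin s] : Matrix (Fin 1) (Fin 1) (F.obj k).carrier) ∈ (F.obj k).cone 1 := by
  obtain ⟨k, f, hf⟩ := hc.exists_map_mem_cone (!![s] : Matrix (Fin 1) (Fin 1) (F.obj j).carrier) (by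
    have e : (!![s]).map (Hom.toLin (c.ι.app j)) = !![Hom.toLin (c.ι.app j) s] := by
      ext p q; simp
    rw [e]
    exact h)
  refine ⟨k, f, ?_⟩
  convert hf using 1
  ext p q; simp

variable [IsFiltered J]

lemma exists_map_eq_zero (hc : IsAlgebraicColimit c) {j : J} (s : (F.obj j).carrier)
    (h : Hom.toLin (c.ι.app j) s = 0) : ∃ (k : J) (f : j ⟶ k), (F.map f).toLin s = 0 := by
  obtain ⟨k, f, hf⟩ := hc.exists_map_mem_cone_one s (by rw [h]; exact zero_mem_cone_one)
  obtain ⟨l, g, hg⟩ := hc.exists_map_mem_cone_one (-s) (by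
    rw [map_neg, h, neg_zero]; exact zero_mem_cone_one)
  obtain ⟨m, a, b, hab⟩ := IsFiltered.span f g
  refine ⟨m, f ≫ a, eq_zero_of_mem_cone_one ?_ ?_⟩
  · rw [map_comp_toLin]
    exact map_mem_cone_one _ hf
  · rw [← map_neg, hab, map_comp_toLin]
    exact map_mem_cone_one _ hg

lemma exists_map_eq (hc : IsAlgebraicColimit c) {i j : J} (s : (F.obj i).carrier)
    (t : (F.obj j).carrier)
    (h : Hom.toLin (c.ι.app i) s = Hom.toLin (c.ι.app j) t) :
    ∃ (k : J) (f : i ⟶ k) (g : j ⟶ k), (F.map f).toLin s = (F.map g).toLin t := by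
  let a := IsFiltered.leftToMax i j
  let b := IsFiltered.rightToMax i j
  obtain ⟨k, f, hf⟩ := hc.exists_map_eq_zero ((F.map a).toLin s - (F.map b).toLin t) (by
    rw [map_sub, ι_map, ι_map, h, sub_self])
  refine ⟨k, a ≫ f, b ≫ f, ?_⟩
  rw [map_comp_toLin, map_comp_toLin, ← sub_eq_zero, ← map_sub, hf]

lemma exists_rep_finite (hc : IsAlgebraicColimit c) {ι : Type*} [Finite ι] (t : ι → c.pt.carrier) :
    ∃ (j : J) (s : ι → (F.obj j).carrier), ∀ i, Hom.toLin (c.ι.app j) (s i) = t i := by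
  classical
  have := Fintype.ofFinite ι
  choose j s hs using fun i => hc.exists_rep (t i)
  obtain ⟨k, hk⟩ := IsFiltered.sup_objs_exists (Finset.univ.image j)
  let f : ∀ i, j i ⟶ k := fun i => (hk (Finset.mem_image_of_mem j (Finset.mem_univ i))).some
  exact ⟨k, fun i => (F.map (f i)).toLin (s i), fun i => by rw [ι_map, hs]⟩

theorem nonempty_isColimit (hc : IsAlgebraicColimit c) : Nonempty (IsColimit c) := by
  have key : ∀ d : Cocone F, ∃ φ : c.pt ⟶ d.pt, ∀ j s,
      φ.toLin (Hom.toLin (c.ι.app j) s) = Hom.toLin (d.ι.app j) s := by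
    intro d
    choose j s hs using hc.exists_rep
    let φ : c.pt.carrier → d.pt.carrier := fun t => Hom.toLin (d.ι.app (j t)) (s t)
    have hφ : ∀ j s, φ (Hom.toLin (c.ι.app j) s) = Hom.toLin (d.ι.app j) s := fun i a => by
      obtain ⟨k, f, g, h⟩ := hc.exists_map_eq _ _ (hs (Hom.toLin (c.ι.app i) a))
      change Hom.toLin (d.ι.app (j _)) (s _) = _
      rw [← ι_map d f, h, ι_map d g]
    refine ⟨⟨⟨⟨φ, fun a b => ?_⟩, fun r a => ?_⟩, ?_, fun {n A} hA => ?_⟩, hφ⟩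
    · obtain ⟨i, w, hw⟩ := hc.exists_rep_finite ![a, b]
      have h0 := hw 0
      have h1 := hw 1
      simp only [cons_val_zero, cons_val_one] at h0 h1
      rw [← h0, ← h1, ← map_add, hφ, hφ, hφ, map_add]
    · obtain ⟨i, w, rfl⟩ := hc.exists_rep a
      dsimp only [RingHom.id_apply]
      rw [← map_smul, hφ, hφ, map_smul]
    · obtain ⟨i⟩ : Nonempty J := IsFiltered.nonempty
      have h1 : Hom.toLin (c.ι.app i) (F.obj i).unit = c.pt.unit := (c.ι.app i).map_unit
      have h2 : Hom.toLin (d.ι.app i) (F.obj i).unit = d.pt.unit := (d.ι.app i).map_unit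
      exact (congrArg φ h1.symm).trans ((hφ _ _).trans h2)
    · obtain ⟨i, w, hw⟩ := hc.exists_rep_finite fun p : Fin n × Fin n => A p.1 p.2
      obtain ⟨k, f, hf⟩ := hc.exists_map_mem_cone (of fun p q => w (p, q)) (by
        have e : (of fun p q => w (p, q)).map (Hom.toLin (c.ι.app i)) = A :=
          Matrix.ext fun p q => hw (p, q)
        rw [e]
        exact hA)
      have e : A.map φ = ((of fun p q => w (p, q)).map (F.map f).toLin).map
          (Hom.toLin (d.ι.app k)) := Matrix.ext fun p q => by
        change φ (A p q) = Hom.toLin (d.ι.app k) ((F.map f).toLin (w (p, q)))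
        rw [ι_map, ← hφ, hw]
      change A.map φ ∈ _
      rw [e]
      exact (d.ι.app k).map_mem hf
  choose φ hφ using key
  exact ⟨{
    desc := φ
    fac := fun d j => OSys.hom_ext fun s => hφ d j s
    uniq := fun d m hm => OSys.hom_ext fun t => by
      obtain ⟨j, s, rfl⟩ := hc.exists_rep t
      rw [hφ]
      exact congrArg (fun χ : F.obj j ⟶ d.pt => χ.toLin s) (hm j) }⟩

end IsAlgebraicColimit

end OSys

namespace OSysC

open OSys

variable {J : Type u} [SmallCategory J]
  [IsCardinalFiltered J (Cardinal.aleph 1 : Cardinal.{u})] (F : J ⥤ OSysC.{u} 𝕜)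

lemma isAlgebraicColimit_colimCocone :
    IsAlgebraicColimit ((OSysC.inclusion 𝕜).mapCocone (colimCocone F)) where
  exists_rep t := by
    obtain ⟨j, s, hs⟩ := exists_evalLim_eq (F := F ⋙ OSysC.inclusion 𝕜)
      (fun j => (F.obj j).stateDetermined) (fun j => (F.obj j).property.1) t.2
    exact ⟨j, s, Subtype.ext hs⟩
  exists_map_mem_cone {n j} A hA := OSys.exists_map_mem_cone (F := F ⋙ OSysC.inclusion 𝕜)
    (fun j => (F.obj j).stateDetermined) A hA

theorem isCardinalAccessible_inclusion :
    (OSysC.inclusion.{u} 𝕜).IsCardinalAccessible (Cardinal.aleph 1 : Cardinal.{u}) where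
  preservesColimitOfShape J _ _ :=
    { preservesColimit := fun {F} => by
        have := isFiltered_of_isCardinalFiltered J (Cardinal.aleph 1 : Cardinal.{u})
        exact preservesColimit_of_preserves_colimit_cocone (isColimitColimCocone F)
          (isAlgebraicColimit_colimCocone F).nonempty_isColimit.some }

end OSysC

end Accessibility

section Generator

open scoped ComplexOrder
open Matrix

variable {𝕜 : Type} [RCLike 𝕜]

lemma posSemidef_one_iff {a : 𝕜} : (!![a] : Matrix (Fin 1) (Fin 1) 𝕜).PosSemidef ↔ 0 ≤ a := by
  have e : (!![a] : Matrix (Fin 1) (Fin 1) 𝕜) = diagonal fun _ => a := by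
    ext i j
    fin_cases i; fin_cases j; simp
  rw [e, posSemidef_diagonal_iff]
  simp

namespace OSys

variable {S T : OSys.{u} 𝕜}

lemma State.nonneg (x : S.State) {s : S.carrier}
    (h : (!![s] : Matrix (Fin 1) (Fin 1) S.carrier) ∈ S.cone 1) : 0 ≤ x.1 s := by
  rw [← posSemidef_one_iff]
  convert x.posSemidef h using 1
  ext i j; simp

lemma StateDetermined.mem_cone_one (hS : S.StateDetermined) {s : S.carrier}
    (h : ∀ x : S.State, 0 ≤ x.1 s) : (!![s] : Matrix (Fin 1) (Fin 1) S.carrier) ∈ S.cone 1 :=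
  hS 1 _ fun x => by
    convert posSemidef_one_iff.2 (h x) using 1
    ext i j; simp

/-- Positive elements below the unit. -/
def IsEffect (S : OSys.{u} 𝕜) (s : S.carrier) : Prop :=
  (!![s] : Matrix (Fin 1) (Fin 1) S.carrier) ∈ S.cone 1 ∧
    (!![S.unit - s] : Matrix (Fin 1) (Fin 1) S.carrier) ∈ S.cone 1

lemma IsEffect.map {s : S.carrier} (h : S.IsEffect s) (f : S ⟶ T) : T.IsEffect (f.toLin s) := by
  refine ⟨map_mem_cone_one f h.1, ?_⟩
  have := map_mem_cone_one f h.2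
  rwa [map_sub, f.map_unit] at this

lemma IsEffect.nonneg {s : S.carrier} (h : S.IsEffect s) (x : S.State) : 0 ≤ x.1 s :=
  x.nonneg h.1

lemma IsEffect.le_one {s : S.carrier} (h : S.IsEffect s) (x : S.State) : x.1 s ≤ 1 := by
  have := x.nonneg h.2
  rwa [x.map_sub, x.map_unit, sub_nonneg] at this

lemma StateDetermined.isEffect (hS : S.StateDetermined) {s : S.carrier}
    (h0 : ∀ x : S.State, 0 ≤ x.1 s) (h1 : ∀ x : S.State, x.1 s ≤ 1) : S.IsEffect s :=
  ⟨hS.mem_cone_one h0, hS.mem_cone_one fun x => by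
    rw [x.map_sub, x.map_unit, sub_nonneg]; exact h1 x⟩

lemma State.coe_re_of_star_eq (x : S.State) {s : S.carrier} (h : star s = s) :
    ((RCLike.re (x.1 s) : ℝ) : 𝕜) = x.1 s := by
  have := x.map_star s
  rw [h, RCLike.star_def] at this
  exact RCLike.conj_eq_iff_re.1 this.symm

lemma StateDetermined.exists_isEffect (hS : S.StateDetermined) {s : S.carrier} (h : star s = s) :
    ∃ r : ℝ, 0 < r ∧ S.IsEffect ((((2 * r)⁻¹ : ℝ) : 𝕜) • (s + (r : 𝕜) • S.unit)) := by
  obtain ⟨r, hr⟩ := exists_normLE s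
  have hr0 : 0 < r + 1 := by linarith [hr.1]
  have key : ∀ x : S.State, x.1 ((((2 * (r + 1))⁻¹ : ℝ) : 𝕜) • (s + ((r + 1 : ℝ) : 𝕜) • S.unit))
      = (((2 * (r + 1))⁻¹ * (RCLike.re (x.1 s) + (r + 1)) : ℝ) : 𝕜) := fun x => by
    rw [x.map_smul, x.map_add, x.map_smul, x.map_unit, mul_one, ← x.coe_re_of_star_eq h]
    push_cast
    simp
  have hb : ∀ x : S.State, |RCLike.re (x.1 s)| ≤ r := fun x =>
    (RCLike.abs_re_le_norm _).trans (x.norm_le hr)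
  refine ⟨r + 1, hr0, hS.isEffect (fun x => ?_) fun x => ?_⟩
  · rw [key]
    have := (abs_le.1 (hb x)).1
    have h2 : 0 ≤ (2 * (r + 1))⁻¹ * (RCLike.re (x.1 s) + (r + 1)) :=
      mul_nonneg (by positivity) (by linarith)
    exact_mod_cast h2
  · rw [key]
    have := (abs_le.1 (hb x)).2
    have h2 : (2 * (r + 1))⁻¹ * (RCLike.re (x.1 s) + (r + 1)) ≤ 1 := by
      rw [inv_mul_le_iff₀ (by positivity)]
      linarith
    exact_mod_cast h2

lemma StateDetermined.eq_re_add_im (hS : S.StateDetermined) (s : S.carrier) :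
    s = (2⁻¹ : 𝕜) • (s + star s) +
      (RCLike.I : 𝕜) • ((-(2⁻¹ * RCLike.I) : 𝕜) • (s - star s)) := by
  refine hS.ext fun x => ?_
  simp only [x.map_add, x.map_smul, x.map_sub, x.map_star, RCLike.star_def]
  rw [RCLike.add_conj, RCLike.sub_conj]
  conv_lhs => rw [← RCLike.re_add_im (x.1 s)]
  rcases RCLike.I_mul_I (K := 𝕜) with h | h
  · simp [h]
  · linear_combination ((RCLike.I : 𝕜) * (RCLike.im (x.1 s) : 𝕜)) * h

lemma star_realPart (s : S.carrier) :
    star ((2⁻¹ : 𝕜) • (s + star s)) = (2⁻¹ : 𝕜) • (s + star s) := by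
  rw [star_smul, star_add, star_star, add_comm]
  simp

lemma star_imaginaryPart (s : S.carrier) :
    star ((-(2⁻¹ * RCLike.I) : 𝕜) • (s - star s)) = (-(2⁻¹ * RCLike.I) : 𝕜) • (s - star s) := by
  rw [star_smul, star_sub, star_star, ← neg_sub, smul_neg, ← neg_smul]
  simp

/-- A system determined by its states is spanned by its effects. -/
lemma StateDetermined.mem_span_isEffect (hS : S.StateDetermined) (s : S.carrier) :
    s ∈ Submodule.span 𝕜 {t | S.IsEffect t} := by
  have hunit : S.unit ∈ Submodule.span 𝕜 {t | S.IsEffect t} :=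
    Submodule.subset_span (hS.isEffect (fun x => by rw [x.map_unit]; exact zero_le_one)
      fun x => by rw [x.map_unit])
  have key : ∀ t : S.carrier, star t = t → t ∈ Submodule.span 𝕜 {t | S.IsEffect t} := by
    intro t ht
    obtain ⟨r, hr, h⟩ := hS.exists_isEffect ht
    have h1 := Submodule.smul_mem _ ((2 * r : ℝ) : 𝕜)
      (Submodule.subset_span (s := {t | S.IsEffect t}) h)
    rw [smul_smul, ← RCLike.ofReal_mul, mul_inv_cancel₀ (by positivity), RCLike.ofReal_one,
      one_smul] at h1
    have h2 := Submodule.sub_mem _ h1 (Submodule.smul_mem _ (r : 𝕜) hunit)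
    rwa [add_sub_cancel_right] at h2
  rw [hS.eq_re_add_im s]
  exact Submodule.add_mem _ (key _ (star_realPart s))
    (Submodule.smul_mem _ _ (key _ (star_imaginaryPart s)))

end OSys

namespace OSysC

open OSys

/-- The unit interval. -/
abbrev Interval : Type u := ULift.{u} (Set.Icc (0 : ℝ) 1)

variable (𝕜)

/-- The inclusion of the unit interval into the scalars. -/
noncomputable def coord : C(Interval.{u}, 𝕜) :=
  ⟨fun x => ((x.down : ℝ) : 𝕜), RCLike.continuous_ofReal.comp
    (continuous_subtype_val.comp continuous_uliftDown)⟩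

/-- The affine functions on the unit interval. -/
noncomputable def intervalFunctions : Submodule 𝕜 C(Interval.{u}, 𝕜) :=
  Submodule.span 𝕜 {1, coord 𝕜}

lemma one_mem_intervalFunctions : 1 ∈ intervalFunctions.{u} 𝕜 :=
  Submodule.subset_span (by simp)

lemma coord_mem : coord 𝕜 ∈ intervalFunctions.{u} 𝕜 := Submodule.subset_span (by simp)

lemma star_mem_intervalFunctions (f) (hf : f ∈ intervalFunctions.{u} 𝕜) :
    star f ∈ intervalFunctions.{u} 𝕜 := by
  obtain ⟨a, b, rfl⟩ := Submodule.mem_span_pair.1 hf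
  have h : star (coord.{u} 𝕜) = coord 𝕜 := ContinuousMap.ext fun x => RCLike.conj_ofReal _
  rw [star_add, star_smul, star_smul, star_one, h]
  exact Submodule.mem_span_pair.2 ⟨_, _, rfl⟩

lemma isClosed_intervalFunctions : IsClosed (intervalFunctions.{u} 𝕜 : Set C(Interval.{u}, 𝕜)) := by
  have : FiniteDimensional 𝕜 (intervalFunctions.{u} 𝕜) :=
    FiniteDimensional.span_of_finite 𝕜 (Set.toFinite _)
  exact Submodule.closed_of_finiteDimensional _

/-- The operator system of affine functions on the unit interval. -/
noncomputable def interval : OSysC.{u} 𝕜 :=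
  ⟨functionSystem Interval.{u} (intervalFunctions 𝕜) (one_mem_intervalFunctions 𝕜)
    (star_mem_intervalFunctions 𝕜),
    isComplete_functionSystem _ _ (isClosed_intervalFunctions 𝕜), isCommutative_functionSystem _ _⟩

/-- The coordinate function as an element of `interval`. -/
noncomputable def intervalCoord : (interval.{u} 𝕜).obj.carrier := ⟨coord 𝕜, coord_mem 𝕜⟩

lemma isEffect_intervalCoord : (interval.{u} 𝕜).obj.IsEffect (intervalCoord 𝕜) := by
  constructor
  · intro p
    have : (0 : 𝕜) ≤ coord 𝕜 p := by
      have := p.down.2.1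
      simpa [coord] using this
    convert posSemidef_one_iff.2 this using 1
    ext i j
    fin_cases i; fin_cases j; rfl
  · intro p
    have : (0 : 𝕜) ≤ 1 - coord 𝕜 p := by
      have := p.down.2.2
      rw [sub_nonneg]
      simp only [coord, ContinuousMap.coe_mk]
      exact_mod_cast this
    convert posSemidef_one_iff.2 this using 1
    ext i j
    fin_cases i; fin_cases j; rfl

variable {𝕜}

lemma exists_interval_hom (T : OSysC.{u} 𝕜) {t : T.obj.carrier} (ht : T.obj.IsEffect t) :
    ∃ φ : interval 𝕜 ⟶ T, φ.hom.toLin (intervalCoord 𝕜) = t := by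
  have hre : ∀ y : T.obj.State, ((RCLike.re (y.1 t) : ℝ) : 𝕜) = y.1 t := fun y =>
    RCLike.conj_eq_iff_re.1 (RCLike.conj_eq_iff_im.2 (RCLike.nonneg_iff.1 (ht.nonneg y)).2)
  let pt : T.obj.State → Interval.{u} := fun y =>
    ⟨⟨RCLike.re (y.1 t), (RCLike.nonneg_iff.1 (ht.nonneg y)).1, by
      have := ht.le_one y
      rw [← hre y] at this
      exact_mod_cast this⟩⟩
  obtain ⟨φ, hφ⟩ := exists_hom_of_stateMap (S := (interval 𝕜).obj) T.stateDetermined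
    (fun y => functionSystemEval (one_mem_intervalFunctions 𝕜) (star_mem_intervalFunctions 𝕜)
      (pt y)) fun f => by
        obtain ⟨f, hf⟩ := f
        obtain ⟨a, b, rfl⟩ := Submodule.mem_span_pair.1 hf
        refine ⟨a • T.obj.unit + b • t, fun y => ?_⟩
        rw [y.map_add, y.map_smul, y.map_smul, y.map_unit, ← hre y]
        rfl
  exact ⟨ObjectProperty.homMk φ, T.stateDetermined.ext fun y => (hφ _ y).trans (hre y)⟩

lemma interval_hom_ext {T : OSysC.{u} 𝕜} {φ ψ : interval 𝕜 ⟶ T}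
    (h : φ.hom.toLin (intervalCoord 𝕜) = ψ.hom.toLin (intervalCoord 𝕜)) : φ = ψ := by
  refine ObjectProperty.hom_ext _ (OSys.hom_ext fun f => ?_)
  obtain ⟨f, hf⟩ := f
  obtain ⟨a, b, rfl⟩ := Submodule.mem_span_pair.1 hf
  have e : (⟨a • 1 + b • coord 𝕜, hf⟩ : (interval 𝕜).obj.carrier)
      = a • (interval 𝕜).obj.unit + b • intervalCoord 𝕜 := rfl
  rw [e, map_add, map_smul, map_smul, map_add, map_smul, map_smul, h, φ.hom.map_unit,
    ψ.hom.map_unit]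

theorem isCardinalPresentable_interval :
    IsCardinalPresentable (interval.{u} 𝕜) (Cardinal.aleph 1 : Cardinal.{u}) where
  preservesColimitOfShape J _ _ :=
    { preservesColimit := fun {F} => by
        have := isFiltered_of_isCardinalFiltered J (Cardinal.aleph 1 : Cardinal.{u})
        have hc := isAlgebraicColimit_colimCocone F
        refine preservesColimit_of_preserves_colimit_cocone (isColimitColimCocone F)
          (Types.FilteredColimit.isColimitOf _ _ ?_ ?_)
        · intro (φ : interval 𝕜 ⟶ colim (F ⋙ OSysC.inclusion 𝕜))
          let c (j : J) : (F.obj j).obj ⟶ (colim (F ⋙ OSysC.inclusion 𝕜)).obj :=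
            ((colimCocone F).ι.app j).hom
          obtain ⟨j, s, hs⟩ : ∃ (j : J) (s : (F.obj j).obj.carrier),
            (c j).toLin s = φ.hom.toLin (intervalCoord 𝕜) := hc.exists_rep _
          have hφ := (isEffect_intervalCoord 𝕜).map φ.hom
          rw [← hs] at hφ
          obtain ⟨k, f, hf⟩ := hc.exists_map_mem_cone_one s hφ.1
          obtain ⟨l, g, hg⟩ := hc.exists_map_mem_cone_one (j := j) ((F.obj j).obj.unit - s) (by
            have h2 := hφ.2
            rw [← (c j).map_unit, ← map_sub] at h2
            exact h2)
          obtain ⟨m, a, b, hab⟩ := IsFiltered.span f g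
          have heff : (F.obj m).obj.IsEffect ((F.map (f ≫ a)).hom.toLin s) := by
            constructor
            · rw [F.map_comp]
              exact map_mem_cone_one (F.map a).hom hf
            · have h2 := map_mem_cone_one (F.map b).hom hg
              rw [hab, ← (F.map (g ≫ b)).hom.map_unit, ← map_sub, F.map_comp]
              exact h2
          obtain ⟨ψ, hψ⟩ := exists_interval_hom (F.obj m) heff
          refine ⟨m, ψ, (interval_hom_ext ?_).symm⟩
          refine Eq.trans ?_ hs
          refine (congrArg (c m).toLin hψ).trans ?_
          exact IsAlgebraicColimit.ι_map ((OSysC.inclusion 𝕜).mapCocone (colimCocone F)) (f ≫ a) s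
        · intro i j (φ : interval 𝕜 ⟶ F.obj i) (ψ : interval 𝕜 ⟶ F.obj j) h
          obtain ⟨k, f, g, hfg⟩ := hc.exists_map_eq (φ.hom.toLin (intervalCoord 𝕜))
            (ψ.hom.toLin (intervalCoord 𝕜))
            (congrArg (fun χ : interval 𝕜 ⟶ colim (F ⋙ OSysC.inclusion 𝕜) =>
              χ.hom.toLin (intervalCoord 𝕜)) h)
          exact ⟨k, f, g, interval_hom_ext hfg⟩ }

lemma hom_ext_of_isEffect {S T : OSysC.{u} 𝕜} {f g : S ⟶ T}
    (h : ∀ s, S.obj.IsEffect s → f.hom.toLin s = g.hom.toLin s) : f = g :=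
  ObjectProperty.hom_ext _ (OSys.hom_ext fun s =>
    LinearMap.eqOn_span (f := f.hom.toLin) (g := g.hom.toLin) h
      (S.stateDetermined.mem_span_isEffect s))

lemma map_star {S T : OSysC.{u} 𝕜} (f : S ⟶ T) (s : S.obj.carrier) :
    f.hom.toLin (star s) = star (f.hom.toLin s) :=
  T.stateDetermined.ext fun x => by
    rw [x.map_star]
    exact (State.comap f.hom x).map_star s

/-- A morphism that is bijective on effects is an isomorphism. -/
lemma isIso_of_isEffect {S T : OSysC.{u} 𝕜} (f : S ⟶ T)
    (hinj : ∀ s s', S.obj.IsEffect s → S.obj.IsEffect s' → f.hom.toLin s = f.hom.toLin s' → s = s')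
    (hsurj : ∀ t, T.obj.IsEffect t → ∃ s, S.obj.IsEffect s ∧ f.hom.toLin s = t) : IsIso f := by
  have hS := S.stateDetermined
  have hT := T.stateDetermined
  have hstar : ∀ s : S.obj.carrier, star s = s → f.hom.toLin s = 0 → s = 0 := by
    intro s hs h0
    obtain ⟨r, hr, he⟩ := hS.exists_isEffect hs
    have hhalf : S.obj.IsEffect ((((2 * r)⁻¹ : ℝ) : 𝕜) • ((r : 𝕜) • S.obj.unit)) := by
      have e : ∀ x : S.obj.State, x.1 ((((2 * r)⁻¹ : ℝ) : 𝕜) • ((r : 𝕜) • S.obj.unit))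
          = ((2⁻¹ : ℝ) : 𝕜) := fun x => by
        rw [x.map_smul, x.map_smul, x.map_unit, mul_one, ← RCLike.ofReal_mul]
        congr 1
        field_simp
      refine hS.isEffect (fun x => ?_) fun x => ?_
      · rw [e]
        exact_mod_cast (by norm_num : (0 : ℝ) ≤ 2⁻¹)
      · rw [e]
        exact_mod_cast (by norm_num : (2⁻¹ : ℝ) ≤ 1)
    have h1 := hinj _ _ he hhalf (by rw [map_smul, map_add, h0, zero_add, ← map_smul])
    rw [smul_add, add_eq_right] at h1
    refine (smul_eq_zero.1 h1).resolve_left ?_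
    exact_mod_cast (by positivity : (2 * r)⁻¹ ≠ 0)
  have hf0 : ∀ s, f.hom.toLin s = 0 → s = 0 := by
    intro s h0
    have h1 : f.hom.toLin (star s) = 0 := by rw [map_star, h0, star_zero]
    rw [hS.eq_re_add_im s, hstar _ (star_realPart s) (by simp [h0, h1]),
      hstar _ (star_imaginaryPart s) (by simp [h0, h1])]
    simp
  have hfinj : Function.Injective f.hom.toLin := (injective_iff_map_eq_zero _).2 hf0
  have hfsurj : Function.Surjective f.hom.toLin := by
    rw [← LinearMap.range_eq_top, eq_top_iff]
    intro t _
    refine Submodule.span_le.2 ?_ (hT.mem_span_isEffect t)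
    intro t ht
    obtain ⟨s, _, rfl⟩ := hsurj t ht
    exact ⟨s, rfl⟩
  have hpos : ∀ s : S.obj.carrier, (∀ y : T.obj.State, 0 ≤ y.1 (f.hom.toLin s)) →
      ∀ x : S.obj.State, 0 ≤ x.1 s := by
    intro s hs x
    obtain ⟨r, hr⟩ := exists_normLE (f.hom.toLin s)
    have hr0 : 0 < r + 1 := by linarith [hr.1]
    have hi : (0 : 𝕜) < (((r + 1)⁻¹ : ℝ) : 𝕜) := by exact_mod_cast inv_pos.2 hr0
    obtain ⟨s', hs', h⟩ := hsurj ((((r + 1)⁻¹ : ℝ) : 𝕜) • f.hom.toLin s) (by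
      refine hT.isEffect (fun y => ?_) fun y => ?_
      · rw [y.map_smul]
        exact mul_nonneg hi.le (hs y)
      · rw [y.map_smul, ← RCLike.conj_eq_iff_re.1
          (RCLike.conj_eq_iff_im.2 (RCLike.nonneg_iff.1 (hs y)).2)]
        have h1 : (r + 1)⁻¹ * RCLike.re (y.1 (f.hom.toLin s)) ≤ 1 := by
          rw [inv_mul_le_iff₀ hr0]
          linarith [(RCLike.re_le_norm _).trans (y.norm_le hr)]
        exact_mod_cast h1)
    rw [← map_smul] at h
    have h2 := hs'.nonneg x
    rw [hfinj h, x.map_smul] at h2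
    have h3 : (0 : 𝕜) ≤ ((r + 1 : ℝ) : 𝕜) := by exact_mod_cast hr0.le
    have h4 := mul_nonneg h3 h2
    rwa [← mul_assoc, ← RCLike.ofReal_mul, mul_inv_cancel₀ hr0.ne', RCLike.ofReal_one,
      one_mul] at h4
  have hcone : ∀ (n : ℕ) (A : Matrix (Fin n) (Fin n) S.obj.carrier),
      A.map f.hom.toLin ∈ T.obj.cone n → A ∈ S.obj.cone n := by
    intro n A hA
    refine hS n A fun x => PosSemidef.of_dotProduct_mulVec_nonneg
      (IsHermitian.ext fun p q => ?_) fun v => ?_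
    · simp only [map_apply]
      rw [← x.map_star]
      refine congrArg x.1 (hfinj ?_)
      rw [map_star]
      exact (OperatorSystem.isHermitian_of_mem (𝕜 := 𝕜) hA).apply p q
    · rw [← x.map_quadraticForm]
      refine hpos _ (fun y => ?_) x
      change 0 ≤ (State.comap f.hom y).1 _
      rw [State.map_quadraticForm]
      exact (y.posSemidef hA).dotProduct_mulVec_nonneg v
  let e := LinearEquiv.ofBijective f.hom.toLin ⟨hfinj, hfsurj⟩
  have he : ∀ t, f.hom.toLin (e.symm t) = t := e.apply_symm_apply
  let g : T.obj ⟶ S.obj :=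
    { toLin := e.symm.toLinearMap
      map_unit := hfinj ((he _).trans f.hom.map_unit.symm)
      map_mem := fun {n A} hA => hcone n _ (by
        have e : (A.map e.symm.toLinearMap).map f.hom.toLin = A := Matrix.ext fun p q => he _
        rw [e]
        exact hA) }
  exact ⟨ObjectProperty.homMk g, ObjectProperty.hom_ext _ (OSys.hom_ext e.symm_apply_apply),
    ObjectProperty.hom_ext _ (OSys.hom_ext he)⟩

theorem isStrongGenerator_interval :
    (ObjectProperty.singleton (interval.{u} 𝕜)).IsStrongGenerator := by
  rw [ObjectProperty.isStrongGenerator_iff]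
  refine ⟨fun S T f g h => hom_ext_of_isEffect fun s hs => ?_, fun S T i _ hi => ?_⟩
  · obtain ⟨φ, rfl⟩ := exists_interval_hom S hs
    exact congrArg (fun χ : interval 𝕜 ⟶ T => χ.hom.toLin (intervalCoord 𝕜)) (h _ (by simp) φ)
  · refine isIso_of_isEffect i (fun s s' hs hs' h => ?_) fun t ht => ?_
    · obtain ⟨φ, rfl⟩ := exists_interval_hom S hs
      obtain ⟨ψ, rfl⟩ := exists_interval_hom S hs'
      have : φ = ψ := by
        rw [← cancel_mono i]
        exact interval_hom_ext h
      rw [this]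
    · obtain ⟨ψ, rfl⟩ := exists_interval_hom T ht
      obtain ⟨φ, rfl⟩ := hi _ (by simp) ψ
      exact ⟨_, (isEffect_intervalCoord 𝕜).map φ.hom, rfl⟩

theorem isCardinalLocallyPresentable :
    IsCardinalLocallyPresentable (OSysC.{u} 𝕜) (Cardinal.aleph 1 : Cardinal.{u}) := by
  rw [IsCardinalLocallyPresentable.iff_exists_isStrongGenerator]
  refine ⟨.singleton (interval 𝕜), inferInstance, isStrongGenerator_interval, ?_⟩
  rw [ObjectProperty.singleton_le_iff, isCardinalPresentable_iff]
  exact isCardinalPresentable_interval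

end OSysC

end Generator

section Duality

open scoped ComplexOrder
open Matrix

variable {𝕜 : Type} [RCLike 𝕜]

/-- A continuous real functional on a product of copies of `𝕜` depends on finitely many
coordinates. -/
lemma exists_finset_forall_eq_zero {I : Type*} (ψ : (I → 𝕜) →L[ℝ] ℝ) :
    ∃ s : Finset I, ∀ f : I → 𝕜, (∀ i ∈ s, f i = 0) → ψ f = 0 := by
  have hU : ψ ⁻¹' Metric.ball 0 1 ∈ nhds (0 : I → 𝕜) :=
    ψ.continuous.continuousAt.preimage_mem_nhds (by
      rw [map_zero]; exact Metric.ball_mem_nhds _ one_pos)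
  rw [nhds_pi, Filter.mem_pi'] at hU
  obtain ⟨s, t, ht, hst⟩ := hU
  refine ⟨s, fun f hf => ?_⟩
  have h1 : ∀ n : ℕ, |ψ f| * n < 1 := fun n => by
    have h2 : (n : ℝ) • f ∈ ψ ⁻¹' Metric.ball 0 1 := hst fun i hi => by
      rw [Pi.smul_apply, hf i hi, smul_zero]
      exact mem_of_mem_nhds (ht i)
    rw [Set.mem_preimage, mem_ball_zero_iff, map_smul, norm_smul, Real.norm_natCast,
      Real.norm_eq_abs] at h2
    linarith
  by_contra h
  obtain ⟨n, hn⟩ := exists_nat_gt (|ψ f|⁻¹)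
  have h3 := abs_pos.2 h
  have h4 := mul_lt_mul_of_pos_left hn h3
  rw [mul_inv_cancel₀ h3.ne'] at h4
  linarith [h1 n]

lemma exists_forall_eq_re_mul (ℓ : 𝕜 →ₗ[ℝ] ℝ) : ∃ c : 𝕜, ∀ z, ℓ z = RCLike.re (c * z) := by
  refine ⟨(ℓ 1 : 𝕜) - (ℓ RCLike.I : 𝕜) * RCLike.I, fun z => ?_⟩
  have h : z = RCLike.re z • (1 : 𝕜) + RCLike.im z • (RCLike.I : 𝕜) := by
    rw [RCLike.real_smul_eq_coe_mul, RCLike.real_smul_eq_coe_mul, mul_one, RCLike.re_add_im]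
  conv_lhs => rw [h]
  rw [map_add, map_smul, map_smul, sub_mul, mul_assoc, map_sub, RCLike.re_ofReal_mul,
    RCLike.re_ofReal_mul, RCLike.I_mul_re, smul_eq_mul, smul_eq_mul]
  ring

namespace OSys

variable {S : OSys.{u} 𝕜}

/-- On states, continuous functionals are evaluations. -/
lemma exists_forall_state_eq_re (ψ : (S.carrier → 𝕜) →L[ℝ] ℝ) :
    ∃ a : S.carrier, ∀ x : S.State, ψ x.1 = RCLike.re (x.1 a) := by
  classical
  obtain ⟨s, hs⟩ := exists_finset_forall_eq_zero ψ
  choose c hc using fun i : S.carrier => exists_forall_eq_re_mul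
    (ψ.toLinearMap ∘ₗ LinearMap.single ℝ (fun _ : S.carrier => 𝕜) i)
  refine ⟨∑ i ∈ s, c i • i, fun x => ?_⟩
  have h := hs (x.1 - ∑ i ∈ s, Pi.single i (x.1 i)) fun j hj => by
    rw [Pi.sub_apply, Finset.sum_apply, Finset.sum_eq_single j]
    · simp
    · intro i _ hij
      exact Pi.single_eq_of_ne hij.symm _
    · exact fun h => absurd hj h
  rw [map_sub, sub_eq_zero, map_sum] at h
  rw [h, x.map_sum, map_sum]
  refine Finset.sum_congr rfl fun i _ => ?_
  rw [x.map_smul]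
  exact hc i (x.1 i)

lemma State.map_realPart (x : S.State) (s : S.carrier) :
    x.1 ((2⁻¹ : 𝕜) • (s + star s)) = (RCLike.re (x.1 s) : 𝕜) := by
  rw [x.map_smul, x.map_add, x.map_star, RCLike.star_def, RCLike.add_conj]
  simp

lemma exists_forall_state_eq_sub_re (u : ℝ) (a : S.carrier) :
    ∃ b : S.carrier, ∀ x : S.State, x.1 b = ((u - RCLike.re (x.1 a) : ℝ) : 𝕜) := by
  refine ⟨(u : 𝕜) • S.unit - (2⁻¹ : 𝕜) • (a + star a), fun x => ?_⟩
  rw [x.map_sub, x.map_realPart, x.map_smul, x.map_unit, mul_one, RCLike.ofReal_sub]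

/-- Continuous real affine functions on the state space are approximated by elements. -/
lemma exists_re_approx (f : S.State → ℝ) (hf : Continuous f) (hf' : S.stateSpace.IsAffine f)
    {ε : ℝ} (hε : 0 < ε) :
    ∃ a : S.carrier, ∀ x : S.State, |RCLike.re (x.1 a) - f x| ≤ ε := by
  have hconv : ∀ δ : ℝ,
      Convex ℝ (Set.range fun x : S.State => ((x.1 : S.carrier → 𝕜), f x + δ)) := by
    rintro δ _ ⟨x, rfl⟩ _ ⟨y, rfl⟩ a b ha hb hab
    refine ⟨⟨_, S.convex_stateSet x.2 y.2 ha hb hab⟩, Prod.ext rfl ?_⟩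
    change f _ + δ = a • (f x + δ) + b • (f y + δ)
    rw [hf' x y ⟨_, S.convex_stateSet x.2 y.2 ha hb hab⟩ a b ha hb hab rfl]
    simp only [smul_eq_mul]
    linear_combination (-δ) * hab
  have hcomp : ∀ δ : ℝ,
      IsCompact (Set.range fun x : S.State => ((x.1 : S.carrier → 𝕜), f x + δ)) := fun δ =>
    isCompact_range (continuous_subtype_val.prodMk (hf.add continuous_const))
  have hdisj : Disjoint (Set.range fun x : S.State => ((x.1 : S.carrier → 𝕜), f x + 0))
      (Set.range fun x : S.State => ((x.1 : S.carrier → 𝕜), f x + ε)) := by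
    rw [Set.disjoint_left]
    rintro _ ⟨x, rfl⟩ ⟨y, hy⟩
    have h1 : y = x := Subtype.ext (congrArg Prod.fst hy)
    have h2 : f y + ε = f x + 0 := congrArg Prod.snd hy
    rw [h1] at h2
    linarith
  obtain ⟨ψ, u, v, hu, huv, hv⟩ := geometric_hahn_banach_compact_closed (hconv 0) (hcomp 0)
    (hconv ε) (hcomp ε).isClosed hdisj
  obtain ⟨a, ha⟩ := exists_forall_state_eq_re
    (ψ.comp (ContinuousLinearMap.inl ℝ (S.carrier → 𝕜) ℝ))
  let c : ℝ := ψ (0, 1)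
  have hψ : ∀ (x : S.State) (t : ℝ), ψ (x.1, t) = RCLike.re (x.1 a) + c * t := fun x t => by
    have e : ((x.1 : S.carrier → 𝕜), t) = (x.1, 0) + t • ((0 : S.carrier → 𝕜), (1 : ℝ)) := by
      ext <;> simp
    rw [e, map_add, map_smul, smul_eq_mul, mul_comm t, ← ha x]
    rfl
  refine ⟨((u / c : ℝ) : 𝕜) • S.unit - ((c⁻¹ : ℝ) : 𝕜) • a, fun x => ?_⟩
  have h1 := hu _ ⟨x, rfl⟩
  have h2 := hv _ ⟨x, rfl⟩
  rw [hψ] at h1 h2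
  have hc : 0 < c := by
    by_contra! h
    nlinarith
  rw [x.map_sub, x.map_smul, x.map_smul, x.map_unit, mul_one, map_sub, RCLike.ofReal_re,
    RCLike.re_ofReal_mul]
  have e : u / c - c⁻¹ * RCLike.re (x.1 a) = (u - RCLike.re (x.1 a)) / c := by
    field_simp
  rw [e, abs_le]
  have h3 : f x ≤ (u - RCLike.re (x.1 a)) / c := by
    rw [le_div_iff₀ hc]
    linarith
  have h4 : (u - RCLike.re (x.1 a)) / c ≤ f x + ε := by
    rw [div_le_iff₀ hc]
    linarith
  constructor <;> linarith

/-- Continuous affine functions on the state space of a complete commutative operator system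
come from elements. -/
lemma exists_forall_eq_of_isAffine (hS : S.StateDetermined) (hc : S.IsComplete)
    (f : C(S.State, 𝕜)) (hf : S.stateSpace.IsAffine f) : ∃ s, ∀ x : S.State, x.1 s = f x := by
  refine exists_forall_eq_of_mem_closure hS hc (Metric.mem_closure_iff.2 fun ε hε => ?_)
  obtain ⟨a, ha⟩ := exists_re_approx (S := S) (fun x => RCLike.re (f x))
    (RCLike.continuous_re.comp f.continuous) (fun x y z p q hp hq hpq h => by
      simp only [hf x y z p q hp hq hpq h, map_add, RCLike.smul_re, smul_eq_mul])
    (ε := ε / 4) (by positivity)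
  obtain ⟨b, hb⟩ := exists_re_approx (S := S) (fun x => RCLike.im (f x))
    (RCLike.continuous_im.comp f.continuous) (fun x y z p q hp hq hpq h => by
      simp only [hf x y z p q hp hq hpq h, map_add, RCLike.smul_im, smul_eq_mul])
    (ε := ε / 4) (by positivity)
  refine ⟨_, ⟨(2⁻¹ : 𝕜) • (a + star a) + (RCLike.I : 𝕜) • ((2⁻¹ : 𝕜) • (b + star b)), rfl⟩, ?_⟩
  rw [dist_comm, dist_eq_norm]
  refine lt_of_le_of_lt ((ContinuousMap.norm_le _ (by positivity : (0 : ℝ) ≤ ε / 2)).2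
    fun x => ?_) (by linarith)
  change ‖x.1 _ - f x‖ ≤ _
  have e : x.1 ((2⁻¹ : 𝕜) • (a + star a) + (RCLike.I : 𝕜) • ((2⁻¹ : 𝕜) • (b + star b))) - f x
      = ((RCLike.re (x.1 a) - RCLike.re (f x) : ℝ) : 𝕜)
        + RCLike.I * ((RCLike.re (x.1 b) - RCLike.im (f x) : ℝ) : 𝕜) := by
    rw [x.map_add, x.map_smul RCLike.I, x.map_realPart, x.map_realPart]
    conv_lhs => rw [← RCLike.re_add_im (f x)]
    push_cast
    ring
  rw [e]
  refine (norm_add_le _ _).trans ?_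
  rw [norm_mul, RCLike.norm_ofReal, RCLike.norm_ofReal]
  have h1 : ‖(RCLike.I : 𝕜)‖ ≤ 1 := by
    rcases RCLike.I_mul_I (K := 𝕜) with h | h
    · simp [h]
    · rw [RCLike.norm_I_of_ne_zero]
      rintro h0
      simp [h0] at h
  have h2 := ha x
  have h3 := hb x
  nlinarith [abs_nonneg (RCLike.re (x.1 b) - RCLike.im (f x))]

end OSys

namespace CompactConvex

open OSys

variable (𝕜)

/-- Evaluation at a point, as a state of `A(K)`. -/
noncomputable def evalPoint (C : CompactConvex.{u}) (p : C.K) : (affineSystem 𝕜 C).State :=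
  functionSystemEval _ _ p

variable {𝕜}

lemma evalPoint_apply (C : CompactConvex.{u}) (p : C.K) (f : (affineSystem 𝕜 C).carrier) :
    (evalPoint 𝕜 C p).1 f = f.1 p := rfl

lemma continuous_evalPoint (C : CompactConvex.{u}) : Continuous (evalPoint 𝕜 C) :=
  Continuous.subtype_mk (continuous_pi fun f => f.1.continuous) _

lemma evalPoint_injective (C : CompactConvex.{u}) : Function.Injective (evalPoint 𝕜 C) := by
  intro p q h
  by_contra hpq
  obtain ⟨ℓ, hℓ⟩ := geometric_hahn_banach_point_point (fun h => hpq (Subtype.ext h) :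
    (p : C.E) ≠ q)
  let f : (affineSystem 𝕜 C).carrier :=
    ⟨⟨fun x => ((ℓ (x : C.E) : ℝ) : 𝕜), RCLike.continuous_ofReal.comp
      (ℓ.continuous.comp continuous_subtype_val)⟩, fun x y z a b _ _ _ h => by
        simp only [ContinuousMap.coe_mk, h, map_add, map_smul, smul_eq_mul,
          RCLike.real_smul_eq_coe_mul]
        push_cast
        rfl⟩
  have h1 : ((ℓ (p : C.E) : ℝ) : 𝕜) = ((ℓ (q : C.E) : ℝ) : 𝕜) :=
    congrFun (congrArg Subtype.val h) f
  exact hℓ.ne (RCLike.ofReal_injective h1)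

/-- Every state of `A(K)` is the evaluation at a point of `K`. -/
lemma evalPoint_surjective (C : CompactConvex.{u}) : Function.Surjective (evalPoint 𝕜 C) := by
  intro x
  by_contra hx
  let Q : Set ((affineSystem 𝕜 C).carrier → 𝕜) := Set.range fun p => (evalPoint 𝕜 C p).1
  have hQ : Convex ℝ Q := by
    rintro _ ⟨p, rfl⟩ _ ⟨q, rfl⟩ a b ha hb hab
    refine ⟨⟨_, C.convex p.2 q.2 ha hb hab⟩, funext fun f => ?_⟩
    exact f.2 p q ⟨_, C.convex p.2 q.2 ha hb hab⟩ a b ha hb hab rfl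
  have hQ' : IsCompact Q := isCompact_range (continuous_subtype_val.comp (continuous_evalPoint C))
  obtain ⟨ψ, u, hψ, hu⟩ := geometric_hahn_banach_closed_point hQ hQ'.isClosed
    (x := x.1) fun ⟨p, hp⟩ => hx ⟨p, Subtype.ext hp⟩
  obtain ⟨a, ha⟩ := exists_forall_state_eq_re (S := affineSystem 𝕜 C) ψ
  obtain ⟨b, hb⟩ := exists_forall_state_eq_sub_re (S := affineSystem 𝕜 C) u a
  have hpos : (!![b] : Matrix (Fin 1) (Fin 1) (affineSystem 𝕜 C).carrier)
      ∈ (affineSystem 𝕜 C).cone 1 := by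
    intro p
    have h1 : (0 : 𝕜) ≤ (evalPoint 𝕜 C p).1 b := by
      rw [hb, ← ha]
      have := (hψ _ ⟨p, rfl⟩).le
      exact_mod_cast sub_nonneg.2 this
    convert posSemidef_one_iff.2 h1 using 1
    ext i j
    fin_cases i; fin_cases j; rfl
  have h2 := x.nonneg hpos
  rw [hb, ← ha] at h2
  have h3 : 0 ≤ u - ψ x.1 := by exact_mod_cast h2
  linarith

lemma isClosed_affineFunctions (C : CompactConvex.{u}) :
    IsClosed (affineFunctions 𝕜 C : Set C(C.K, 𝕜)) := by
  change IsClosed {f : C(C.K, 𝕜) | ∀ (x y z : C.K) (a b : ℝ), 0 ≤ a → 0 ≤ b → a + b = 1 →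
    (z : C.E) = a • (x : C.E) + b • (y : C.E) → f z = a • f x + b • f y}
  simp only [Set.ofPred_forall]
  refine isClosed_iInter fun x => isClosed_iInter fun y => isClosed_iInter fun z =>
    isClosed_iInter fun a => isClosed_iInter fun b => isClosed_iInter fun _ =>
    isClosed_iInter fun _ => isClosed_iInter fun _ => isClosed_iInter fun _ => ?_
  exact isClosed_eq (continuous_eval_const z)
    (((continuous_eval_const x).const_smul a).add ((continuous_eval_const y).const_smul b))

variable (𝕜)

lemma isComplete_affineSystem (C : CompactConvex.{u}) : (affineSystem 𝕜 C).IsComplete :=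
  isComplete_functionSystem _ _ (isClosed_affineFunctions C)

lemma isCommutative_affineSystem (C : CompactConvex.{u}) : (affineSystem 𝕜 C).IsCommutative :=
  isCommutative_functionSystem _ _

/-- The functor `K ↦ A(K)` with values in complete commutative operator systems. -/
noncomputable def affineFunctorC : CompactConvex.{u}ᵒᵖ ⥤ OSysC.{u} 𝕜 :=
  ObjectProperty.lift _ (affineFunctor 𝕜) fun C =>
    ⟨isComplete_affineSystem 𝕜 C.unop, isCommutative_affineSystem 𝕜 C.unop⟩

instance : (affineFunctorC.{u} 𝕜).Faithful where
  map_injective {C D} f g h := by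
    refine Quiver.Hom.unop_inj (Hom.ext (ContinuousMap.ext fun p => ?_))
    refine evalPoint_injective (𝕜 := 𝕜) C.unop (Subtype.ext (funext fun a => ?_))
    have h1 := congrArg (fun χ => χ.hom) h
    have h2 : ((affineFunctor 𝕜).map f).toLin a = ((affineFunctor 𝕜).map g).toLin a :=
      congrArg (fun χ : (affineFunctor 𝕜).obj C ⟶ (affineFunctor 𝕜).obj D => χ.toLin a) h1
    exact congrArg (fun k : (affineSystem 𝕜 D.unop).carrier => k.1 p) h2

instance : (affineFunctorC.{u} 𝕜).Full where
  map_surjective {C D} φ := by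
    let φ' : affineSystem 𝕜 C.unop ⟶ affineSystem 𝕜 D.unop := φ.hom
    choose p hp using fun q : D.unop.K =>
      evalPoint_surjective C.unop (State.comap φ' (evalPoint 𝕜 D.unop q))
    have hp' : ∀ q (f : (affineSystem 𝕜 C.unop).carrier), f.1 (p q) = (φ'.toLin f).1 q :=
      fun q f => congrFun (congrArg Subtype.val (hp q)) f
    have hcont : Continuous p := by
      rw [((continuous_evalPoint (𝕜 := 𝕜) C.unop).isClosedEmbedding
        (evalPoint_injective C.unop)).isInducing.continuous_iff]
      have : evalPoint 𝕜 C.unop ∘ p = fun q => State.comap φ' (evalPoint 𝕜 D.unop q) := funext hp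
      rw [this]
      exact (State.continuous_comap φ').comp (continuous_evalPoint D.unop)
    have haff : D.unop.IsAffine fun q => (p q : C.unop.E) := by
      intro x y z a b ha hb hab h
      let w : C.unop.K := ⟨_, C.unop.convex (p x).2 (p y).2 ha hb hab⟩
      have : p z = w := by
        refine evalPoint_injective (𝕜 := 𝕜) C.unop (Subtype.ext (funext fun f => ?_))
        rw [evalPoint_apply, evalPoint_apply, hp', f.2 (p x) (p y) w a b ha hb hab rfl, hp', hp']
        exact (φ'.toLin f).2 x y z a b ha hb hab h
      exact congrArg Subtype.val this
    let f : D.unop ⟶ C.unop := ⟨⟨p, hcont⟩, haff⟩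
    refine ⟨f.op, ObjectProperty.hom_ext _ (OSys.hom_ext fun g => Subtype.ext
      (ContinuousMap.ext fun q => hp' q g))⟩

instance : (affineFunctorC.{u} 𝕜).EssSurj where
  mem_essImage T := by
    let C := T.obj.stateSpace
    let η : T.obj ⟶ affineSystem 𝕜 C :=
      { toLin :=
          { toFun := fun t => ⟨T.obj.evalState t, fun x y z a b _ _ _ h => congrFun h t⟩
            map_add' := fun a b => Subtype.ext (T.obj.evalState.map_add a b)
            map_smul' := fun c a => Subtype.ext (T.obj.evalState.map_smul c a) }
        map_unit := Subtype.ext (ContinuousMap.ext fun x => State.map_unit x)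
        map_mem := fun hA x => State.posSemidef x hA }
    obtain ⟨ψ, hψ⟩ := exists_hom_of_stateMap (S := affineSystem 𝕜 C) T.stateDetermined
      (fun x => evalPoint 𝕜 C x) fun f =>
        exists_forall_eq_of_isAffine T.stateDetermined T.property.1 f.1 f.2
    refine ⟨Opposite.op C, ⟨ObjectProperty.isoMk _
      { hom := ψ
        inv := η
        hom_inv_id := OSys.hom_ext fun f => Subtype.ext (ContinuousMap.ext fun x => hψ f x)
        inv_hom_id := T.stateDetermined.hom_ext fun t x => hψ _ x }⟩⟩

instance : (affineFunctorC.{u} 𝕜).IsEquivalence where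

theorem isCardinalAccessible_affineFunctor :
    (affineFunctor.{u} 𝕜).IsCardinalAccessible (Cardinal.aleph 1 : Cardinal.{u}) := by
  have := OSysC.isCardinalAccessible_inclusion.{u} (𝕜 := 𝕜)
  have : (affineFunctorC.{u} 𝕜 ⋙ OSysC.inclusion.{u} 𝕜).IsCardinalAccessible
    (Cardinal.aleph 1 : Cardinal.{u}) := inferInstance
  exact this

end CompactConvex

end Duality

theorem mainTheorem5 (𝕜 : Type) [RCLike 𝕜] :
    -- `OSysC` is complete
    HasLimits (OSysC.{u} 𝕜) ∧
    -- it is a full reflective subcategory of `OSys`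
    (OSysC.inclusion.{u} 𝕜).Full ∧ (OSysC.inclusion.{u} 𝕜).Faithful ∧
    (OSysC.inclusion.{u} 𝕜).IsRightAdjoint ∧
    -- it is locally `ℵ₁`-presentable
    IsCardinalLocallyPresentable (OSysC.{u} 𝕜) (Cardinal.aleph 1 : Cardinal.{u}) ∧
    -- the inclusion preserves `ℵ₁`-directed colimits
    (OSysC.inclusion.{u} 𝕜).IsCardinalAccessible (Cardinal.aleph 1 : Cardinal.{u}) ∧
    -- `K ↦ A(K)` sends `ℵ₁`-directed limits of compact convex sets to colimits in `OSys`
    (CompactConvex.affineFunctor.{u} 𝕜).IsCardinalAccessible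
      (Cardinal.aleph 1 : Cardinal.{u}) :=
  ⟨OSysC.hasLimits, inferInstance, inferInstance, OSysC.isRightAdjoint_inclusion,
    OSysC.isCardinalLocallyPresentable, OSysC.isCardinalAccessible_inclusion,
    CompactConvex.isCardinalAccessible_affineFunctor 𝕜⟩
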